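/- **Setting.** Consider an episodic Markov decision process with finite state space $\mathscr S$, finite action space $\mathscr A$, transition probabilities $p$, rewards $r:\mathscr S\times\mathscr A\times\mathscr S\to[-r_{\max},r_{\max}]$ with $r_{\max}>0$, discount factor $\gamma\in(0,1)$, fixed start state $S_0$ and an absorbing terminal state $0$. Let $\{\pi_\theta(a|s):\theta\in\mathbb R^d\}$ be stochastic policies. Under $\pi_\theta$, $A_t\sim\pi_\theta(\cdot|S_t)$ and $S_{t+1}\sim p(\cdot|S_t,A_t)$; let $T$ be the first time at which state $0$ is visited, $R^\theta=\sum_{t=0}^{T-1}\gamma^t r(S_t,A_t,S_{t+1})$, $F_{R^\theta}$ its distribution function, and $M_r=\frac{r_{\max}}{1-\gamma}$. Let $g:[0,1]\to[0,1]$ be a distortion function (non-decreasing, $g(0)=0$, $g(1)=1$), and let $$\rho_g(\theta)=\int_{-M_r}^0\big(g(1-F_{R^\theta}(x))-1\big)\,dx+\int_0^{M_r}g(1-F_{R^\theta}(x))\,dx,\qquad \rho_g^*=\sup_{\theta\in\mathbb R^d}\rho_g(\theta).$$ **Algorithm (DRM-OnP-LR).** Fix $\theta_0\in\mathbb R^d$,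 a step-size $\alpha>0$, a batch size $m\ge1$ and a number of iterations $N\ge1$. For $k=0,\dots,N-1$, given the past, generate $m$ independent episodes with the policy $\pi_{\theta_k}$, with rewards $R_i$, lengths $T^i$, states $S^i_t$ and actions $A^i_t$ ($1\le i\le m$), and set $\theta_{k+1}=\theta_k+\alpha\,\widehat\nabla^G\rho_g(\theta_k)$, where, for $\theta=\theta_k$, $$\widehat\nabla^G\rho_g(\theta)=-\int_{-M_r}^{M_r}g'(1-G^m(x))\,\widehat\nabla G^m(x)\,dx,$$ $$G^m(x)=\frac1m\sum_{i=1}^m\mathbf 1\{R_i\le x\},\qquad \widehat\nabla G^m(x)=\frac1m\sum_{i=1}^m\mathbf 1\{R_i\le x\}\sum_{t=0}^{T^i-1}\nabla\log\pi_\theta(A^i_t|S^i_t).$$ Here $\nabla$ is the gradient in $\theta$, and $g'(0)$ is the right derivative of $g$ at $0$. (Where $G^m(x)=0$ the integrand is zero.) The output is $\theta_R$ with $R$ uniformly distributed on $\{1,\dots,N\}$ and independent of the iterates. **Theorem.** Assume that: 1. the policies are proper: there is $M>0$ such that $\max_{s\in\mathscr S}\mathbb P(S_M\ne0\mid S_0=s,\pi_\theta)<1$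 for all $\theta$; and $M_e>0$ is an upper bound on the episode length, that is, $T\le M_e$ almost surely under every $\pi_\theta$; 2. $\pi_\theta(a|s)>0$, and $\theta\mapsto\log\pi_\theta(a|s)$ is twice differentiable with $\|\nabla\log\pi_\theta(a|s)\|\le M_d$ (Euclidean norm) and $\|\nabla^2\log\pi_\theta(a|s)\|\le M_h$ (operator norm), for all $\theta,a,s$, where $M_d,M_h>0$; 3. $g$ is twice differentiable on $(0,1)$ with $|g'|\le M_{g'}$ and $|g''|\le M_{g''}$ there, where $M_{g'},M_{g''}>0$, and $g$ has a right derivative at $0$. Then $\rho_g$ is differentiable and bounded above, $\|\nabla\rho_g(\theta_R)\|^2$ is integrable, and $$\mathbb E\|\nabla\rho_g(\theta_R)\|^2\le\frac{2\left(\rho_g^*-\rho_g(\theta_0)\right)}{N\alpha}+4M_r^2M_e^2M_d^2\left(\alpha M_{g'}^2L_{\rho'}+\frac{8\left(e^2M_{g'}^2+M_{g''}^2\right)}{m}\right),$$ where $L_{\rho'}=2M_rM_e\left(M_hM_{g'}+M_eM_d^2(M_{g'}+M_{g''})\right)$. -/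

import Mathlib

open MeasureTheory ProbabilityTheory
open scoped ENNReal

noncomputable section

namespace DRM

/-- An episodic Markov decision process on a state space `S` and an action space `A`, with
bounded rewards, discount factor, fixed start state, and absorbing terminal state. -/
structure EpisodicMDP (S A : Type*) where
  /-- reward for the transition from `s` to `s'` under the action `a` -/
  reward : S → A → S → ℝ
  /-- bound on the rewards -/
  rMax : ℝ
  /-- transition law: `trans s a s'` is the probability of moving from `s` to `s'` under `a` -/
  trans : S → A → PMF S
  /-- discount factor -/
  γ : ℝ
  /-- the special absorbing state, at which episodes terminate -/
  term : S
  /-- the fixed start state of the episodes -/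
  start : S
  rMax_pos : 0 < rMax
  abs_reward_le : ∀ s a s', |reward s a s'| ≤ rMax
  γ_pos : 0 < γ
  γ_lt_one : γ < 1
  absorbing : ∀ a, trans term a = PMF.pure term

/-- The parameter space `ℝᵈ` with its Euclidean norm. -/
abbrev Param (d : ℕ) : Type := EuclideanSpace ℝ (Fin d)

/-- A parameterized family of stochastic policies: `π θ s a` is the probability `π_θ(a | s)`. -/
abbrev Policy (d : ℕ) (S A : Type*) : Type _ := Param d → S → PMF A

/-- A trajectory `(S₀, A₀), (S₁, A₁), …`. -/
abbrev Trajectory (S A : Type*) : Type _ := ℕ → S × A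

variable {S A : Type*} {d : ℕ}

section Law

variable [Finite S] [Finite A] [MeasurableSpace S] [MeasurableSpace A]
  [MeasurableSingletonClass S] [MeasurableSingletonClass A]

/-- The law of `(s, a)` with `a ∼ π_θ(· | s)`. -/
def stateActionLaw (π : Policy d S A) (θ : Param d) (s : S) : PMF (S × A) :=
  (π θ s).map (fun a => (s, a))

/-- One step of the chain: given the history up to time `n`, the next state is drawn from
`p(· | S_n, A_n)` and the next action from `π_θ(· | S_{n+1})`. -/
def stepKernel (M : EpisodicMDP S A) (π : Policy d S A) (θ : Param d) (n : ℕ) :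
    Kernel ((_ : Finset.Iic n) → S × A) (S × A) :=
  Kernel.ofFunOfCountable fun h =>
    let x := h ⟨n, Finset.mem_Iic.2 le_rfl⟩
    ((M.trans x.1 x.2).bind (stateActionLaw π θ)).toMeasure

instance (M : EpisodicMDP S A) (π : Policy d S A) (θ : Param d) (n : ℕ) :
    IsMarkovKernel (stepKernel M π θ n) :=
  ⟨fun _ => PMF.toMeasure.isProbabilityMeasure _⟩

/-- The law of the trajectory started at `S₀ = s` and controlled by the policy `π_θ`. -/
def trajLaw (M : EpisodicMDP S A) (π : Policy d S A) (θ : Param d) (s : S) :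
    Measure (Trajectory S A) :=
  Kernel.trajMeasure (X := fun _ => S × A) (stateActionLaw π θ s).toMeasure (stepKernel M π θ)

/-- The law of an episode: the trajectory starts at the fixed start state. -/
def episodeLaw (M : EpisodicMDP S A) (π : Policy d S A) (θ : Param d) :
    Measure (Trajectory S A) :=
  trajLaw M π θ M.start

/-- The policies are proper: there is a time `n > 0` such that, under every policy `π_θ`, from
every state, the terminal state is reached by time `n` with positive probability. -/
def IsProper (M : EpisodicMDP S A) (π : Policy d S A) : Prop :=
  ∃ n : ℕ, 0 < n ∧ ∀ θ s, trajLaw M π θ s {ω | (ω n).1 ≠ M.term} < 1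

end Law

section Episode

/-- The length `T` of an episode: the first time at which the terminal state is visited
(infinite if this never happens). -/
def episodeLength (M : EpisodicMDP S A) (ω : Trajectory S A) : ℕ∞ :=
  ⨅ (t : ℕ) (_ : (ω t).1 = M.term), (t : ℕ∞)

/-- The cumulative discounted reward `R = ∑_{t < T} γᵗ r(S_t, A_t, S_{t+1})` of an episode
of finite length. -/
def cumReward (M : EpisodicMDP S A) (ω : Trajectory S A) : ℝ :=
  ∑ t ∈ Finset.range (episodeLength M ω).toNat,
    M.γ ^ t * M.reward (ω t).1 (ω t).2 (ω (t + 1)).1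

/-- The log-likelihood `θ ↦ log π_θ(a | s)`. -/
def logPolicy (π : Policy d S A) (s : S) (a : A) (θ : Param d) : ℝ :=
  Real.log (π θ s a).toReal

/-- The sum `∑_{t < T} ∇ log π_θ(A_t | S_t)` over an episode of finite length. -/
def episodeScore (M : EpisodicMDP S A) (π : Policy d S A) (θ : Param d)
    (ω : Trajectory S A) : Param d :=
  ∑ t ∈ Finset.range (episodeLength M ω).toNat,
    gradient (logPolicy π (ω t).1 (ω t).2) θ

/-- The bound `M_r = r_max / (1 - γ)` on the cumulative reward. -/
def EpisodicMDP.rewardBound (M : EpisodicMDP S A) : ℝ := M.rMax / (1 - M.γ)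

end Episode

section Distortion

/-- `g` (restricted to `[0,1]`) is a distortion function. -/
structure IsDistortion (g : ℝ → ℝ) : Prop where
  mapsTo : Set.MapsTo g (Set.Icc 0 1) (Set.Icc 0 1)
  mono : MonotoneOn g (Set.Icc 0 1)
  zero : g 0 = 0
  one : g 1 = 1

variable [Finite S] [Finite A] [MeasurableSpace S] [MeasurableSpace A]
  [MeasurableSingletonClass S] [MeasurableSingletonClass A]

/-- The cumulative distribution function of the cumulative reward `R^θ`. -/
def rewardCDF (M : EpisodicMDP S A) (π : Policy d S A) (θ : Param d) (x : ℝ) : ℝ :=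
  (episodeLaw M π θ).real {ω | cumReward M ω ≤ x}

/-- The distortion risk measure `ρ_g(θ)` of the cumulative reward. -/
def drm (M : EpisodicMDP S A) (π : Policy d S A) (g : ℝ → ℝ) (θ : Param d) : ℝ :=
  (∫ x in (-M.rewardBound)..0, (g (1 - rewardCDF M π θ x) - 1)) +
    ∫ x in (0)..M.rewardBound, g (1 - rewardCDF M π θ x)

end Distortion

section Estimator

/-- The empirical distribution function of the rewards of `m` episodes. -/
def empCDF (M : EpisodicMDP S A) {m : ℕ} (w : Fin m → Trajectory S A) (x : ℝ) : ℝ :=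
  (m : ℝ)⁻¹ * ∑ i, Set.indicator {ω | cumReward M ω ≤ x} (fun _ => (1 : ℝ)) (w i)

/-- The likelihood-ratio estimate, from `m` episodes, of the gradient in `θ` of the distribution
function of `R^θ` at `x`. -/
def gradEmpCDF (M : EpisodicMDP S A) (π : Policy d S A) (θ : Param d) {m : ℕ}
    (w : Fin m → Trajectory S A) (x : ℝ) : Param d :=
  (m : ℝ)⁻¹ • ∑ i, Set.indicator {ω | cumReward M ω ≤ x} (episodeScore M π θ) (w i)

/-- The estimate of `∇ρ_g(θ)` from `m` episodes. The derivative of `g` is taken within `[0,1]`,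
so it is the usual one in `(0,1)` and the right derivative at `0`; at `1` its value is
multiplied by the zero vector. -/
def gradEstimate (M : EpisodicMDP S A) (π : Policy d S A) (g : ℝ → ℝ) (θ : Param d) {m : ℕ}
    (w : Fin m → Trajectory S A) : Param d :=
  -∫ x in (-M.rewardBound)..M.rewardBound,
    derivWithin g (Set.Icc 0 1) (1 - empCDF M w x) • gradEmpCDF M π θ w x

end Estimator

section Algorithm

variable [Finite S] [Finite A] [MeasurableSpace S] [MeasurableSpace A]
  [MeasurableSingletonClass S] [MeasurableSingletonClass A]

/-- The law of a batch of `m` independent episodes generated by the policy `π_θ`. -/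
def batchLaw (M : EpisodicMDP S A) (π : Policy d S A) (m : ℕ) (θ : Param d) :
    Measure (Fin m → Trajectory S A) :=
  Measure.pi fun _ => episodeLaw M π θ

/-- A run of `N` iterations of the on-policy likelihood-ratio DRM gradient ascent with step-size
`α` and batch size `m`, started at `θ₀`, on a probability space with a filtration `ℱ`:
`θ k` is the `k`-th iterate, `W k` is the batch of episodes generated in iteration `k`, and `R` is
the index of the output. -/
structure IsRun (M : EpisodicMDP S A) (π : Policy d S A) (g : ℝ → ℝ) (N m : ℕ) (α : ℝ)
    (θ₀ : Param d) {Ω : Type*} [mΩ : MeasurableSpace Ω] (P : Measure Ω)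
    (ℱ : Filtration ℕ mΩ)
    (W : ℕ → Ω → Fin m → Trajectory S A) (θ : ℕ → Ω → Param d) (R : Ω → ℕ) : Prop where
  init : ∀ ω, θ 0 ω = θ₀
  update : ∀ k < N, ∀ ω, θ (k + 1) ω = θ k ω + α • gradEstimate M π g (θ k ω) (W k ω)
  measurable_iterate : ∀ k ≤ N, Measurable[ℱ k] (θ k)
  measurable_batch : ∀ k < N, Measurable[ℱ (k + 1)] (W k)
  /-- Given the past, the `k`-th batch consists of `m` independent episodes generated by the
  policy `π_{θ_k}`. -/
  batch_law : ∀ k < N, ∀ E : Set Ω, MeasurableSet[ℱ k] E →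
    ∀ B : Set (Fin m → Trajectory S A), MeasurableSet B →
      P (E ∩ W k ⁻¹' B) = ∫⁻ ω in E, batchLaw M π m (θ k ω) B ∂P
  measurable_index : Measurable R
  /-- The index of the output is uniformly distributed on `{1, …, N}` … -/
  index_uniform : ∀ k ∈ Finset.Icc 1 N, P (R ⁻¹' {k}) = (N : ℝ≥0∞)⁻¹
  /-- … and independent of the iterates. -/
  index_indep : IndepFun R (fun ω (k : Fin N) => θ (k + 1) ω) P

end Algorithm

/-- The Lipschitz constant `L_{ρ'}` of the gradient of the distortion risk measure. -/
def smoothConst (Mr Me Md Mh Mg' Mg'' : ℝ) : ℝ :=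
  2 * Mr * Me * (Mh * Mg' + Me * Md ^ 2 * (Mg' + Mg''))

end DRM

end

/-! Since episodes last at most `Me` steps, an episode is described almost surely by its first `⌊Me⌋
+ 1` state-action pairs, so the randomness lives on a finite set `H` of paths. A path has
probability `c · exp (∑ log π_θ)`, where `c` does not depend on `θ`; hence its log-gradient is the
episode score, bounded by `Me * Md`, with derivative bounded by `Me * Mh`
(`exists_isEpisodePartition`). Positivity of the policies makes the set of charged paths the same
for all `θ`.

The distribution function at `x` is then the probability of the subset `{X ≤ x}` of `H`. Grouping
the `x` with the same subset `V` turns `ρ_g` into a finite sum `∑ V, len V * g (1 - P_θ V)` minus a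
constant (`drm_eq`), with total weight `2 * Mr`. Differentiating gives a gradient that is bounded
and Lipschitz with the stated constant. The estimator is the same sum with empirical means in place
of probabilities (`gradEstimate_eq`), so its mean squared error is of order `1 / m`
(`sum_norm_sq_finEstimate_sub_le`).

The estimator is biased, but the ascent step needs only its mean squared error: polarization gives
`⟪∇ρ, e⟫ = (‖∇ρ‖² + ‖e‖² - ‖e - ∇ρ‖²) / 2`, which enters the quadratic lower bound of
`le_of_lipschitz_gradient`. Telescoping controls the iterates `0, …, N - 1`, whereas the output is
drawn from `1, …, N`. The first term is dropped, and the last one is absorbed by `‖∇ρ‖² ≤ 2 L (ρ* -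
ρ)` when `α * L ≤ 1`. When `α * L > 1` the claim follows from the uniform bound on `‖∇ρ‖`. -/

namespace DRM

/-! ### Probabilities of finite paths, with terminal actions identified. -/

section Paths

variable {S A : Type*} {d : ℕ}

open Classical in
/-- Identify all state-action pairs at the terminal state with `(term, a₀)`. -/
noncomputable def collapse (M : EpisodicMDP S A) (a₀ : A) (x : S × A) : S × A :=
  if x.1 = M.term then (M.term, a₀) else x

lemma collapse_fst (M : EpisodicMDP S A) (a₀ : A) (x : S × A) : (collapse M a₀ x).1 = x.1 := by
  unfold collapse; split_ifs with h <;> simp [h]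

lemma collapse_of_ne (M : EpisodicMDP S A) (a₀ : A) {x : S × A} (hx : x.1 ≠ M.term) :
    collapse M a₀ x = x := by
  simp [collapse, hx]

lemma fst_eq_of_collapse_eq {M : EpisodicMDP S A} {a₀ : A} {x y : S × A}
    (h : collapse M a₀ x = collapse M a₀ y) : x.1 = y.1 := by
  rw [← collapse_fst M a₀ x, h, collapse_fst]

lemma eq_of_collapse_eq {M : EpisodicMDP S A} {a₀ : A} {x y : S × A}
    (h : collapse M a₀ x = collapse M a₀ y) (hy : y.1 ≠ M.term) : x = y := by
  have hx : x.1 ≠ M.term := by rwa [fst_eq_of_collapse_eq h]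
  rwa [collapse_of_ne M a₀ hx, collapse_of_ne M a₀ hy] at h

/-- Absorption makes the action irrelevant at the terminal state, so the transition law descends to
collapsed pairs. -/
lemma trans_eq_of_collapse_eq {M : EpisodicMDP S A} {a₀ : A} {x y : S × A}
    (h : collapse M a₀ x = collapse M a₀ y) : M.trans x.1 x.2 = M.trans y.1 y.2 := by
  by_cases hy : y.1 = M.term
  · rw [fst_eq_of_collapse_eq h, hy, M.absorbing, M.absorbing]
  · rw [eq_of_collapse_eq h hy]

open Classical in
/-- The probability of the action of a state-action pair, actions at the terminal state being
identified with each other. -/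
noncomputable def actionWeight (M : EpisodicMDP S A) (π : Policy d S A) (θ : Param d)
    (x : S × A) : ℝ≥0∞ :=
  if x.1 = M.term then 1 else π θ x.1 x.2

/-- The trajectories that agree with `y` up to time `n`, up to actions at the terminal state. -/
def pathCylinder (M : EpisodicMDP S A) (a₀ : A) (n : ℕ) (y : Trajectory S A) :
    Set (Trajectory S A) :=
  {ω | ∀ t ≤ n, collapse M a₀ (ω t) = collapse M a₀ (y t)}

lemma pathCylinder_succ (M : EpisodicMDP S A) (a₀ : A) (n : ℕ) (y : Trajectory S A) :
    pathCylinder M a₀ (n + 1) y =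
      pathCylinder M a₀ n y ∩ {ω | collapse M a₀ (ω (n + 1)) = collapse M a₀ (y (n + 1))} := by
  ext ω
  simp only [pathCylinder, Set.mem_ofPred_eq, Set.mem_inter_iff]
  constructor
  · exact fun h => ⟨fun t ht => h t (by omega), h _ le_rfl⟩
  · rintro ⟨h, h'⟩ t ht
    rcases Nat.lt_or_ge n t with h1 | h1
    · obtain rfl : t = n + 1 := by omega
      exact h'
    · exact h t h1

open Classical in
/-- The part of the probability of a path that does not depend on the policy. -/
noncomputable def transWeight (M : EpisodicMDP S A) (n : ℕ) (y : Trajectory S A) : ℝ≥0∞ :=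
  (if (y 0).1 = M.start then 1 else 0) *
    ∏ t ∈ Finset.range n, M.trans (y t).1 (y t).2 (y (t + 1)).1

variable [Finite S] [Finite A] [MeasurableSpace S] [MeasurableSpace A]
  [MeasurableSingletonClass S] [MeasurableSingletonClass A]

lemma measurableSet_collapse_eq (M : EpisodicMDP S A) (a₀ : A) (z : S × A) (t : ℕ) :
    MeasurableSet {ω : Trajectory S A | collapse M a₀ (ω t) = z} :=
  measurableSet_preimage (f := fun ω : Trajectory S A => ω t) (measurable_pi_apply t)
    (Set.toFinite {x | collapse M a₀ x = z}).measurableSet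

open Classical in
lemma stateActionLaw_collapse (M : EpisodicMDP S A) (π : Policy d S A) (a₀ : A) (θ : Param d)
    (s : S) (x : S × A) :
    (stateActionLaw π θ s).toMeasure {z | collapse M a₀ z = collapse M a₀ x} =
      if x.1 = s then actionWeight M π θ x else 0 := by
  rw [stateActionLaw, PMF.toMeasure_map_apply _ _ _ (measurable_of_countable _)
    (Set.toFinite _).measurableSet]
  by_cases hs : x.1 = s
  · rw [if_pos hs, actionWeight]
    subst hs
    split_ifs with h
    · convert measure_univ (μ := (π θ x.1).toMeasure) using 2
      · ext a
        simp [collapse, h]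
    · rw [← (π θ x.1).toMeasure_apply_singleton x.2 (measurableSet_singleton _)]
      congr 1
      ext a
      simp only [Set.mem_preimage, Set.mem_ofPred_eq, Set.mem_singleton_iff]
      constructor
      · intro ha
        exact congrArg Prod.snd (eq_of_collapse_eq ha h)
      · rintro rfl; rfl
  · rw [if_neg hs]
    convert measure_empty (μ := (π θ s).toMeasure)
    ext a
    simp only [Set.mem_preimage, Set.mem_ofPred_eq, Set.mem_empty_iff_false, iff_false]
    exact fun ha => hs (fst_eq_of_collapse_eq ha).symm

lemma step_collapse (M : EpisodicMDP S A) (π : Policy d S A) (a₀ : A) (θ : Param d)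
    (x x' : S × A) :
    ((M.trans x.1 x.2).bind (stateActionLaw π θ)).toMeasure
        {z | collapse M a₀ z = collapse M a₀ x'} =
      M.trans x.1 x.2 x'.1 * actionWeight M π θ x' := by
  classical
  rw [PMF.toMeasure_bind_apply _ _ _ (Set.toFinite _).measurableSet,
    tsum_eq_single x'.1]
  · rw [stateActionLaw_collapse, if_pos rfl]
  · intro s hs
    rw [stateActionLaw_collapse, if_neg hs.symm, mul_zero]

instance (M : EpisodicMDP S A) (π : Policy d S A) (θ : Param d) :
    IsProbabilityMeasure (episodeLaw M π θ) := by
  unfold episodeLaw trajLaw; infer_instance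

lemma map_eval_zero_trajMeasure {X : ℕ → Type*} [∀ n, MeasurableSpace (X n)]
    (μ₀ : Measure (X 0)) [IsProbabilityMeasure μ₀]
    (κ : (n : ℕ) → Kernel (Π i : Finset.Iic n, X i) (X (n + 1))) [∀ n, IsMarkovKernel (κ n)] :
    (Kernel.trajMeasure μ₀ κ).map (fun x => x 0) = μ₀ := by
  let f : (Π i : Finset.Iic 0, X i) → X 0 := fun h => h ⟨0, Finset.mem_Iic.2 le_rfl⟩
  have hf : Measurable f := measurable_pi_apply _
  have h : (fun x : Π n, X n => x 0) = f ∘ Preorder.frestrictLe 0 := rfl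
  rw [h, ← Measure.map_map hf (by fun_prop), Kernel.trajMeasure,
    Measure.map_comp _ _ (by fun_prop), Kernel.traj_map_frestrictLe, Kernel.partialTraj_self,
    Measure.id_comp]
  let e : X 0 → Π i : Finset.Iic 0, X i :=
    (MeasurableEquiv.piUnique (fun i : Finset.Iic 0 => X i)).symm
  have he : Measurable e := MeasurableEquiv.measurable _
  exact (Measure.map_map hf he).trans Measure.map_id

/-- Chain rule by induction on `n`. Collapsing removes the action probabilities at the terminal
state, which the episode score does not see either. -/
lemma episodeLaw_pathCylinder (M : EpisodicMDP S A) (π : Policy d S A) (a₀ : A) (θ : Param d)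
    (n : ℕ) (y : Trajectory S A) :
    episodeLaw M π θ (pathCylinder M a₀ n y) =
      transWeight M n y * ∏ t ∈ Finset.range (n + 1), actionWeight M π θ (y t) := by
  classical
  induction n with
  | zero =>
    have h : pathCylinder M a₀ 0 y =
        (fun ω : Trajectory S A => ω 0) ⁻¹' {z | collapse M a₀ z = collapse M a₀ (y 0)} := by
      ext; simp [pathCylinder]
    have hm : Measurable (fun ω : Trajectory S A => ω 0) := measurable_pi_apply 0
    rw [h, ← Measure.map_apply hm (Set.toFinite _).measurableSet, episodeLaw, trajLaw,
      map_eval_zero_trajMeasure (X := fun _ => S × A), stateActionLaw_collapse]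
    simp [transWeight]
  | succ n ih =>
    have hset : pathCylinder M a₀ (n + 1) y =
        (fun ω : Trajectory S A => (Preorder.frestrictLe (π := fun _ => S × A) n ω, ω (n + 1))) ⁻¹'
          ({h : (i : Finset.Iic n) → S × A |
              ∀ t (ht : t ≤ n), collapse M a₀ (h ⟨t, Finset.mem_Iic.2 ht⟩) = collapse M a₀ (y t)} ×ˢ
            {z | collapse M a₀ z = collapse M a₀ (y (n + 1))}) := by
      rw [pathCylinder_succ]
      rfl
    have hset' : pathCylinder M a₀ n y = (Preorder.frestrictLe (π := fun _ => S × A) n) ⁻¹'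
          {h : (i : Finset.Iic n) → S × A |
              ∀ t (ht : t ≤ n), collapse M a₀ (h ⟨t, Finset.mem_Iic.2 ht⟩) = collapse M a₀ (y t)} :=
      rfl
    have hm : Measurable (fun ω : Trajectory S A =>
        (Preorder.frestrictLe (π := fun _ => S × A) n ω, ω (n + 1))) := by fun_prop
    have hms : MeasurableSet {h : (i : Finset.Iic n) → S × A |
              ∀ t (ht : t ≤ n), collapse M a₀ (h ⟨t, Finset.mem_Iic.2 ht⟩) = collapse M a₀ (y t)} :=
      (Set.toFinite _).measurableSet
    have hmt : MeasurableSet {z | collapse M a₀ z = collapse M a₀ (y (n + 1))} :=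
      (Set.toFinite _).measurableSet
    rw [hset, ← Measure.map_apply hm (hms.prod hmt), episodeLaw, trajLaw,
      ← Kernel.map_frestrictLe_trajMeasure_compProd_eq_map_trajMeasure (X := fun _ => S × A),
      Measure.compProd_apply_prod hms hmt]
    -- The kernel depends on the history only through its last pair up to collapsing, so it is
    -- constant on the cylinder and leaves the integral.
    have hstep : ∀ h ∈ {h : (i : Finset.Iic n) → S × A |
        ∀ t (ht : t ≤ n), collapse M a₀ (h ⟨t, Finset.mem_Iic.2 ht⟩) = collapse M a₀ (y t)},
        stepKernel M π θ n h {z | collapse M a₀ z = collapse M a₀ (y (n + 1))} =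
          M.trans (y n).1 (y n).2 (y (n + 1)).1 * actionWeight M π θ (y (n + 1)) := by
      intro h hh
      rw [← trans_eq_of_collapse_eq (hh n le_rfl), ← step_collapse M π a₀]
      rfl
    rw [setLIntegral_congr_fun hms hstep, setLIntegral_const,
      Measure.map_apply (by fun_prop) hms, ← hset']
    rw [episodeLaw, trajLaw] at ih
    rw [ih, transWeight, transWeight, Finset.prod_range_succ _ (n + 1),
      Finset.prod_range_succ (fun t => M.trans (y t).1 (y t).2 (y (t + 1)).1) n]
    ring

end Paths

/-! ### Length, reward and score are determined by a finite path. -/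

section Episodes

variable {S A : Type*} {d : ℕ}

lemma episodeLength_eq_iff (M : EpisodicMDP S A) (ω : Trajectory S A) (T : ℕ) :
    episodeLength M ω = T ↔ (ω T).1 = M.term ∧ ∀ t < T, (ω t).1 ≠ M.term := by
  constructor
  · intro h
    have hlt : ∀ t < T, (ω t).1 ≠ M.term := by
      intro t ht hterm
      have h1 : episodeLength M ω ≤ t := iInf₂_le t hterm
      rw [h, Nat.cast_le] at h1
      omega
    refine ⟨?_, hlt⟩
    by_contra hT
    have h2 : ((T + 1 : ℕ) : ℕ∞) ≤ episodeLength M ω := by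
      refine le_iInf₂ fun t ht => ?_
      rw [Nat.cast_le]
      by_contra hlt'
      rcases Nat.lt_or_ge t T with h3 | h3
      · exact hlt t h3 ht
      · obtain rfl : t = T := by omega
        exact hT ht
    rw [h, Nat.cast_le] at h2
    omega
  · rintro ⟨hT, hlt⟩
    refine le_antisymm (iInf₂_le T hT) (le_iInf₂ fun t ht => ?_)
    rw [Nat.cast_le]
    by_contra h
    exact hlt t (by omega) ht

lemma episodeLength_congr {M : EpisodicMDP S A} {a₀ : A} {n T : ℕ} {y ω : Trajectory S A}
    (hT : episodeLength M y = T) (hTn : T ≤ n) (hω : ω ∈ pathCylinder M a₀ n y) :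
    episodeLength M ω = T := by
  rw [episodeLength_eq_iff] at hT ⊢
  rw [fst_eq_of_collapse_eq (hω T hTn)]
  refine ⟨hT.1, fun t ht => ?_⟩
  rw [fst_eq_of_collapse_eq (hω t (by omega))]
  exact hT.2 t ht

/-- Before `T` the pairs are not terminal, so collapsing loses nothing. The last reward also
involves the state at time `T`, but not the action there. -/
lemma cumReward_congr {M : EpisodicMDP S A} {a₀ : A} {n T : ℕ} {y ω : Trajectory S A}
    (hT : episodeLength M y = T) (hTn : T ≤ n) (hω : ω ∈ pathCylinder M a₀ n y) :
    cumReward M ω = cumReward M y := by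
  rw [cumReward, cumReward, episodeLength_congr hT hTn hω, hT, ENat.toNat_natCast]
  refine Finset.sum_congr rfl fun t ht => ?_
  rw [Finset.mem_range] at ht
  rw [episodeLength_eq_iff] at hT
  rw [eq_of_collapse_eq (hω t (by omega)) (hT.2 t ht),
    fst_eq_of_collapse_eq (hω (t + 1) (by omega))]

lemma episodeScore_congr {M : EpisodicMDP S A} (π : Policy d S A) (θ : Param d) {a₀ : A} {n T : ℕ}
    {y ω : Trajectory S A}
    (hT : episodeLength M y = T) (hTn : T ≤ n) (hω : ω ∈ pathCylinder M a₀ n y) :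
    episodeScore M π θ ω = episodeScore M π θ y := by
  rw [episodeScore, episodeScore, episodeLength_congr hT hTn hω, hT, ENat.toNat_natCast]
  refine Finset.sum_congr rfl fun t ht => ?_
  rw [Finset.mem_range] at ht
  rw [episodeLength_eq_iff] at hT
  rw [eq_of_collapse_eq (hω t (by omega)) (hT.2 t ht)]

lemma fst_eq_term_of_transWeight_ne_zero {M : EpisodicMDP S A} {n T : ℕ} {y : Trajectory S A}
    (hw : transWeight M n y ≠ 0) (hT : (y T).1 = M.term) {t : ℕ} (hTt : T ≤ t) (htn : t ≤ n) :
    (y t).1 = M.term := by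
  induction t, hTt using Nat.le_induction with
  | base => exact hT
  | succ t hTt ih =>
    have ih := ih (by omega)
    have h := Finset.prod_ne_zero_iff.1 (right_ne_zero_of_mul hw) t
      (Finset.mem_range.2 (by omega))
    rw [ih, M.absorbing] at h
    by_contra hne
    rw [PMF.pure_apply_of_ne _ _ hne] at h
    exact h rfl

lemma transWeight_ne_top (M : EpisodicMDP S A) (n : ℕ) (y : Trajectory S A) :
    transWeight M n y ≠ ⊤ := by
  rw [transWeight]
  refine ENNReal.mul_ne_top (by split_ifs <;> simp)
    (ENNReal.prod_ne_top fun t _ => PMF.apply_ne_top _ _)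

/-- A path with nonzero transition weight stays at the terminal state from `T` on, where each action
weight is `1`; only the factors with `t < T` remain. -/
lemma prod_actionWeight {M : EpisodicMDP S A} (π : Policy d S A) (hpos : ∀ θ s a, π θ s a ≠ 0)
    (θ : Param d) {n T : ℕ} {y : Trajectory S A} (hw : transWeight M n y ≠ 0)
    (hT : episodeLength M y = T) (hTn : T ≤ n) :
    ∏ t ∈ Finset.range (n + 1), actionWeight M π θ (y t) =
      ENNReal.ofReal (Real.exp (∑ t ∈ Finset.range T, logPolicy π (y t).1 (y t).2 θ)) := by
  rw [episodeLength_eq_iff] at hT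
  rw [Real.exp_sum, ENNReal.ofReal_prod_of_nonneg fun _ _ => (Real.exp_pos _).le,
    ← Finset.prod_range_mul_prod_Ico _ (show T ≤ n + 1 by omega)]
  rw [Finset.prod_eq_one (s := Finset.Ico T (n + 1)), mul_one]
  · refine Finset.prod_congr rfl fun t ht => ?_
    rw [actionWeight, if_neg (hT.2 t (Finset.mem_range.1 ht)), logPolicy, Real.exp_log,
      ENNReal.ofReal_toReal (PMF.apply_ne_top _ _)]
    exact ENNReal.toReal_pos (hpos _ _ _) (PMF.apply_ne_top _ _)
  · intro t ht
    rw [Finset.mem_Ico] at ht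
    rw [actionWeight, if_pos]
    exact fst_eq_term_of_transWeight_ne_zero hw hT.1 ht.1 (by omega)

end Episodes

/-- A family of positive probability vectors on a finite type, differentiable in the parameter,
whose score `∇ log p` is bounded by `B` and has a derivative bounded by `C`. -/
structure IsSmoothFamily {E H : Type*} [NormedAddCommGroup E] [InnerProductSpace ℝ E]
    [CompleteSpace E] [Fintype H] (p : E → H → ℝ) (u : E → H → E) (B C : ℝ) : Prop where
  pos : ∀ θ h, 0 < p θ h
  sum_eq_one : ∀ θ, ∑ h, p θ h = 1
  hasGradientAt : ∀ θ h, HasGradientAt (fun ϑ => p ϑ h) (p θ h • u θ h) θ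
  norm_score_le : ∀ θ h, ‖u θ h‖ ≤ B
  differentiable_score : ∀ h, Differentiable ℝ (fun ϑ => u ϑ h)
  norm_fderiv_score_le : ∀ θ h, ‖fderiv ℝ (fun ϑ => u ϑ h) θ‖ ≤ C

/-- A finite family of events which carries the laws of the episodes, such that the reward and the
score of an episode only depend on the event it belongs to. -/
structure IsEpisodePartition {S A H : Type*} {d : ℕ} [Finite S] [Finite A]
    [MeasurableSpace S] [MeasurableSpace A]
    [MeasurableSingletonClass S] [MeasurableSingletonClass A] (M : EpisodicMDP S A)
    (π : Policy d S A) (K : H → Set (Trajectory S A)) (X : H → ℝ)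
    (p : Param d → H → ℝ) (u : Param d → H → Param d) : Prop where
  measurableSet : ∀ h, MeasurableSet (K h)
  disjoint : Pairwise (Function.onFun Disjoint K)
  law : ∀ θ h, episodeLaw M π θ (K h) = ENNReal.ofReal (p θ h)
  reward : ∀ h, ∀ ω ∈ K h, cumReward M ω = X h
  score : ∀ θ h, ∀ ω ∈ K h, episodeScore M π θ ω = u θ h

/-- The likelihood-ratio identity `∇p = p ∇ log p` for a path probability. -/
lemma hasGradientAt_const_mul_exp_sum {E ι : Type*} [NormedAddCommGroup E] [InnerProductSpace ℝ E]
    [CompleteSpace E] (c : ℝ) (s : Finset ι) {f : ι → E → ℝ} {x : E}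
    (hf : ∀ i ∈ s, DifferentiableAt ℝ (f i) x) :
    HasGradientAt (fun y => c * Real.exp (∑ i ∈ s, f i y))
      ((c * Real.exp (∑ i ∈ s, f i x)) • ∑ i ∈ s, gradient (f i) x) x := by
  have h1 : HasFDerivAt (fun y => ∑ i ∈ s, f i y)
      (∑ i ∈ s, InnerProductSpace.toDual ℝ E (gradient (f i) x)) x :=
    HasFDerivAt.fun_sum fun i hi => (hf i hi).hasGradientAt.hasFDerivAt
  rw [hasGradientAt_iff_hasFDerivAt]
  refine (h1.exp.const_mul c).congr_fderiv ?_
  rw [map_smulₛₗ, map_sum, smul_smul]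
  rfl

/-! ### Reduction to a finite smooth family of path probabilities. -/

section Model

universe u v

variable {S : Type u} {A : Type v} {d : ℕ} [Finite S] [Finite A]
  [MeasurableSpace S] [MeasurableSpace A]
  [MeasurableSingletonClass S] [MeasurableSingletonClass A]

lemma exists_isEpisodePartition (M : EpisodicMDP S A) (π : Policy d S A) {Me Md Mh : ℝ}
    (hMd : 0 < Md) (hMh : 0 < Mh)
    (hlength : ∀ θ, ∀ᵐ ω ∂(episodeLaw M π θ),
      ∃ n : ℕ, episodeLength M ω = n ∧ (n : ℝ) ≤ Me)
    (hpos : ∀ θ s a, π θ s a ≠ 0)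
    (hdiff : ∀ s a, Differentiable ℝ (logPolicy π s a))
    (hdiff2 : ∀ s a, Differentiable ℝ (gradient (logPolicy π s a)))
    (hscore : ∀ θ s a, ‖gradient (logPolicy π s a) θ‖ ≤ Md)
    (hhess : ∀ θ s a, ‖fderiv ℝ (gradient (logPolicy π s a)) θ‖ ≤ Mh) :
    ∃ (H : Type (max u v)) (_ : Fintype H) (K : H → Set (Trajectory S A)) (X : H → ℝ)
      (p : Param d → H → ℝ) (u : Param d → H → Param d),
      IsSmoothFamily p u (Me * Md) (Me * Mh) ∧ IsEpisodePartition M π K X p u := by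
  classical
  have := Fintype.ofFinite S
  have := Fintype.ofFinite A
  obtain ⟨a₀, -⟩ := (π 0 M.start).support_nonempty
  -- An integer length at most `Me` is at most `⌊Me⌋`, so times `0, …, n` cover the episode and its
  -- terminal state.
  set n := ⌊Me⌋₊ with hn
  let K' : (Fin (n + 1) → S × A) → Set (Trajectory S A) :=
    fun y => {ω | ∀ i : Fin (n + 1), collapse M a₀ (ω i) = y i}
  have hK' : ∀ y, ∀ ω ∈ K' y, K' y = pathCylinder M a₀ n ω := by
    intro y ω hω
    ext ω'
    constructor
    · intro h t ht
      have h1 := h ⟨t, by omega⟩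
      have h2 := hω ⟨t, by omega⟩
      exact h1.trans h2.symm
    · intro h i
      exact (h i (by omega)).trans (hω i)
  have hK'm : ∀ y, MeasurableSet (K' y) := by
    intro y
    have : K' y = ⋂ i : Fin (n + 1), {ω | collapse M a₀ (ω i) = y i} := by
      ext; simp [K']
    rw [this]
    exact .iInter fun i => measurableSet_collapse_eq M a₀ _ _
  have hK'd : Pairwise (Function.onFun Disjoint K') := by
    intro y y' hne
    rw [Function.onFun, Set.disjoint_left]
    intro ω h h'
    exact hne (funext fun i => (h i).symm.trans (h' i))
  -- Only cylinders charged by some policy are kept: such a cylinder contains a path of length at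
  -- most `Me`, which represents it.
  let H := {y : Fin (n + 1) → S × A // ∃ θ, episodeLaw M π θ (K' y) ≠ 0}
  have hrep : ∀ h : H, ∃ ω ∈ K' h.1, ∃ T : ℕ, episodeLength M ω = T ∧ (T : ℝ) ≤ Me := by
    rintro ⟨y, θ, hθ⟩
    by_contra! hcon
    refine hθ (measure_mono_null ?_ (hlength θ))
    intro ω hω
    rw [Set.mem_compl_iff]
    rintro ⟨T, h1, h2⟩
    exact absurd h2 (not_le.2 (hcon ω hω T h1))
  choose rep hrepK T hT hTMe using hrep
  have hTn : ∀ h, T h ≤ n := fun h => Nat.le_floor (hTMe h)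
  have hlaw : ∀ θ h, episodeLaw M π θ (K' h.1) = transWeight M n (rep h) *
      ∏ t ∈ Finset.range (n + 1), actionWeight M π θ (rep h t) := by
    intro θ h
    rw [hK' _ _ (hrepK h), episodeLaw_pathCylinder]
  have hw : ∀ h, transWeight M n (rep h) ≠ 0 := by
    rintro h hzero
    obtain ⟨θ, hθ⟩ := h.2
    rw [hlaw, hzero, zero_mul] at hθ
    exact hθ rfl
  let ℓ : H → ℕ → Param d → ℝ := fun h t => logPolicy π (rep h t).1 (rep h t).2
  let p : Param d → H → ℝ := fun θ h =>
    (transWeight M n (rep h)).toReal * Real.exp (∑ t ∈ Finset.range (T h), ℓ h t θ)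
  let u : Param d → H → Param d := fun θ h =>
    ∑ t ∈ Finset.range (T h), gradient (ℓ h t) θ
  have hlaw' : ∀ θ h, episodeLaw M π θ (K' h.1) = ENNReal.ofReal (p θ h) := by
    intro θ h
    rw [hlaw, prod_actionWeight π hpos θ (hw h) (hT h) (hTn h),
      ENNReal.ofReal_mul ENNReal.toReal_nonneg, ENNReal.ofReal_toReal (transWeight_ne_top _ _ _)]
  have hu : ∀ h, ∀ θ, HasFDerivAt (fun ϑ => u ϑ h)
      (∑ t ∈ Finset.range (T h), fderiv ℝ (gradient (ℓ h t)) θ) θ := fun h θ =>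
    HasFDerivAt.fun_sum fun t _ => (hdiff2 _ _ θ).hasFDerivAt
  have hppos : ∀ θ h, 0 < p θ h := fun θ h =>
    mul_pos (ENNReal.toReal_pos (hw h) (transWeight_ne_top _ _ _)) (Real.exp_pos _)
  refine ⟨H, inferInstance, fun h => K' h.1, fun h => cumReward M (rep h), p, u,
    ⟨hppos, ?_, ?_, ?_, fun h θ => (hu h θ).differentiableAt, ?_⟩,
    ⟨fun h => hK'm h.1, ?_, hlaw', ?_, ?_⟩⟩
  · intro θ
    have h1 : ∑ y, episodeLaw M π θ (K' y) = 1 := by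
      rw [← tsum_fintype (L := .unconditional _), ← measure_iUnion hK'd hK'm,
        ← measure_univ (μ := episodeLaw M π θ)]
      congr 1
      exact Set.eq_univ_of_forall fun ω =>
        Set.mem_iUnion.2 ⟨fun i => collapse M a₀ (ω i), fun i => rfl⟩
    -- The discarded cylinders are null under every `θ`, so the kept ones carry full mass.
    rw [← Fintype.sum_subtype_add_sum_subtype (fun y => ∃ θ, episodeLaw M π θ (K' y) ≠ 0),
      Finset.sum_eq_zero (s := (Finset.univ : Finset {y // ¬ ∃ θ, episodeLaw M π θ (K' y) ≠ 0})),
      add_zero] at h1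
    · have h2 : ENNReal.ofReal (∑ h, p θ h) = 1 := by
        rw [ENNReal.ofReal_sum_of_nonneg fun h _ => (hppos θ h).le, ← h1]
        exact Finset.sum_congr rfl fun h _ => (hlaw' θ h).symm
      exact ENNReal.ofReal_eq_one.1 h2
    · rintro ⟨y, hy⟩ -
      by_contra hne
      exact hy ⟨θ, hne⟩
  · exact fun θ h => hasGradientAt_const_mul_exp_sum _ _ fun t _ => hdiff _ _ θ
  · intro θ h
    calc ‖u θ h‖ ≤ ∑ t ∈ Finset.range (T h), Md := norm_sum_le_of_le _ fun t _ => hscore _ _ _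
      _ = T h * Md := by simp
      _ ≤ Me * Md := by gcongr; exact hTMe h
  · intro θ h
    rw [(hu h θ).fderiv]
    calc _ ≤ ∑ t ∈ Finset.range (T h), Mh := norm_sum_le_of_le _ fun t _ => hhess _ _ _
      _ = T h * Mh := by simp
      _ ≤ Me * Mh := by gcongr; exact hTMe h
  · exact fun h h' hne => hK'd fun heq => hne (Subtype.ext heq)
  · intro h ω hω
    rw [hK' _ _ (hrepK h)] at hω
    exact cumReward_congr (hT h) (hTn h) hω
  · intro θ h ω hω
    rw [hK' _ _ (hrepK h)] at hω
    rw [episodeScore_congr π θ (hT h) (hTn h) hω, episodeScore, hT h, ENat.toNat_natCast]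

end Model

/-! ### Functions with Lipschitz gradient. -/

section Smooth

variable {E : Type*} [NormedAddCommGroup E] [InnerProductSpace ℝ E] [CompleteSpace E]

/-- The quadratic lower bound for a function with Lipschitz gradient. -/
lemma le_of_lipschitz_gradient {f : E → ℝ} {f' : E → E} {L : ℝ}
    (hf : ∀ x, HasGradientAt f (f' x) x) (hL : ∀ x y, ‖f' x - f' y‖ ≤ L * ‖x - y‖) (x v : E) :
    f x + inner ℝ (f' x) v - L / 2 * ‖v‖ ^ 2 ≤ f (x + v) := by
  -- The difference of the two sides along the segment, up to a constant; the Lipschitz bound makes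
  -- its derivative nonnegative.
  let ψ : ℝ → ℝ := fun t => f (x + t • v) - t * inner ℝ (f' x) v + L / 2 * t ^ 2 * ‖v‖ ^ 2
  have hψ : ∀ t, HasDerivAt ψ
      (inner ℝ (f' (x + t • v)) v - inner ℝ (f' x) v + L * t * ‖v‖ ^ 2) t := by
    intro t
    have h1 : HasDerivAt (fun t : ℝ => x + t • v) v t := by
      simpa using ((hasDerivAt_id t).smul_const v).const_add x
    have h2 : HasDerivAt (fun t : ℝ => f (x + t • v)) (inner ℝ (f' (x + t • v)) v) t := by
      have h := HasFDerivAt.comp_hasDerivAt (f := fun t : ℝ => x + t • v) t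
        (hf (x + t • v)).hasFDerivAt h1
      rwa [InnerProductSpace.toDual_apply_apply] at h
    have h3 := (h2.sub ((hasDerivAt_id t).mul_const (inner ℝ (f' x) v))).add
      ((((hasDerivAt_id t).pow 2).const_mul (L / 2)).mul_const (‖v‖ ^ 2))
    refine h3.congr_deriv ?_
    simp only [id]
    ring
  have hmono : MonotoneOn ψ (Set.Icc 0 1) := by
    refine monotoneOn_of_hasDerivWithinAt_nonneg (convex_Icc 0 1)
      (fun t _ => (hψ t).continuousAt.continuousWithinAt)
      (fun t _ => (hψ t).hasDerivWithinAt) fun t ht => ?_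
    rw [interior_Icc] at ht
    rw [← inner_sub_left]
    have h1 := abs_le.1 (abs_real_inner_le_norm (f' (x + t • v) - f' x) v)
    have h2 := hL (x + t • v) x
    rw [add_sub_cancel_left, norm_smul, Real.norm_of_nonneg ht.1.le] at h2
    nlinarith [mul_le_mul_of_nonneg_right h2 (norm_nonneg v), h1.1]
  have h := hmono (Set.left_mem_Icc.2 zero_le_one) (Set.right_mem_Icc.2 zero_le_one) zero_le_one
  simp only [ψ, zero_smul, add_zero, one_smul] at h
  linarith

lemma norm_sq_gradient_le_of_bddAbove {f : E → ℝ} {f' : E → E} {L : ℝ} (hL0 : 0 < L)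
    (hf : ∀ x, HasGradientAt f (f' x) x) (hL : ∀ x y, ‖f' x - f' y‖ ≤ L * ‖x - y‖)
    {b : ℝ} (hb : ∀ x, f x ≤ b) (x : E) :
    ‖f' x‖ ^ 2 ≤ 2 * L * (b - f x) := by
  -- The step `L⁻¹ • f' x` maximizes the quadratic lower bound.
  have h := (le_of_lipschitz_gradient hf hL x (L⁻¹ • f' x)).trans (hb _)
  rw [inner_smul_right, real_inner_self_eq_norm_sq, norm_smul, Real.norm_of_nonneg (by positivity)]
    at h
  have h2 : L⁻¹ * ‖f' x‖ ^ 2 - L / 2 * (L⁻¹ * ‖f' x‖) ^ 2 = ‖f' x‖ ^ 2 / (2 * L) := by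
    field_simp; ring
  have h3 : ‖f' x‖ ^ 2 / (2 * L) ≤ b - f x := by linarith
  rw [div_le_iff₀ (by positivity)] at h3
  linarith

end Smooth

/-! ### Lipschitz extension of the derivative of the distortion. -/

section DistortionDeriv

open Filter Topology

/-- A bounded Lipschitz function that agrees on `[0, 1)` with the derivative of `g`. -/
structure IsDistortionDeriv (g k : ℝ → ℝ) (c c' : ℝ) : Prop where
  lipschitz : ∀ s t, |k s - k t| ≤ c' * |s - t|
  abs_le : ∀ t ∈ Set.Icc (0 : ℝ) 1, |k t| ≤ c
  hasDerivAt : ∀ t ∈ Set.Ioo (0 : ℝ) 1, HasDerivAt g (k t) t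
  derivWithin_eq : ∀ t ∈ Set.Ico (0 : ℝ) 1, derivWithin g (Set.Icc 0 1) t = k t

/-- The derivative of a function with bounded second derivative extends to a Lipschitz
function. -/
lemma exists_isDistortionDeriv {g : ℝ → ℝ} {c c' : ℝ} (hc' : 0 ≤ c')
    (hg0 : DifferentiableWithinAt ℝ g (Set.Icc 0 1) 0)
    (hg1 : ∀ t ∈ Set.Ioo (0 : ℝ) 1, DifferentiableAt ℝ g t ∧ |deriv g t| ≤ c)
    (hg2 : ∀ t ∈ Set.Ioo (0 : ℝ) 1,
      DifferentiableAt ℝ (deriv g) t ∧ |deriv (deriv g) t| ≤ c') :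
    ∃ k : ℝ → ℝ, IsDistortionDeriv g k c c' := by
  have hlip : LipschitzOnWith c'.toNNReal (deriv g) (Set.Ioo 0 1) := by
    refine (convex_Ioo 0 1).lipschitzOnWith_of_nnnorm_deriv_le (fun t ht => (hg2 t ht).1)
      fun t ht => ?_
    rw [← NNReal.coe_le_coe, coe_nnnorm, Real.coe_toNNReal _ hc']
    exact (hg2 t ht).2
  obtain ⟨k, hk, hkeq⟩ := hlip.extend_real
  have hd : ∀ t ∈ Set.Ioo (0 : ℝ) 1, HasDerivAt g (k t) t := fun t ht => by
    rw [← hkeq ht]; exact (hg1 t ht).1.hasDerivAt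
  refine ⟨k, fun s t => ?_, fun t ht => ?_, hd, fun t ht => ?_⟩
  · have := hk.dist_le_mul s t
    rwa [Real.coe_toNNReal _ hc', Real.dist_eq, Real.dist_eq] at this
  -- The bound passes from the open interval to its closure by continuity of `k`.
  · have hcl : Set.Icc (0 : ℝ) 1 ⊆ {t | |k t| ≤ c} := by
      rw [← closure_Ioo (zero_ne_one' ℝ)]
      refine closure_minimal (fun t ht => ?_) (isClosed_le hk.continuous.abs continuous_const)
      rw [Set.mem_ofPred_eq, ← hkeq ht]
      exact (hg1 t ht).2
    exact hcl ht
  · rcases ht.1.eq_or_lt with rfl | h0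
    -- The right derivative at `0` is the limit of the derivatives from the right. The hypothesis at
    -- `0` supplies the continuity of `g` that this requires.
    · have hnhds : Set.Ioo (0 : ℝ) 1 ∈ 𝓝[>] (0 : ℝ) := Ioo_mem_nhdsGT zero_lt_one
      have hlim : Tendsto (fun x => deriv g x) (𝓝[>] 0) (𝓝 (k 0)) := by
        refine (hk.continuous.continuousAt.tendsto.mono_left nhdsWithin_le_nhds).congr' ?_
        filter_upwards [hnhds] with x hx using (hkeq hx).symm
      have hcont : ContinuousWithinAt g (Set.Ioo 0 1) 0 :=
        hg0.continuousWithinAt.mono Set.Ioo_subset_Icc_self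
      have h1 := hasDerivWithinAt_Ici_of_tendsto_deriv
        (fun t ht => (hg1 t ht).1.differentiableWithinAt) hcont hnhds hlim
      exact (h1.mono Set.Icc_subset_Ici_self).derivWithin
        (uniqueDiffOn_Icc zero_lt_one 0 (Set.left_mem_Icc.2 zero_le_one))
    · rw [derivWithin_of_mem_nhds (Icc_mem_nhds h0 ht.2), (hd t ⟨h0, ht.2⟩).deriv]

end DistortionDeriv

/-! ### Mean squared error of an empirical mean over a finite space. -/

section Variance

variable {E H : Type*} [NormedAddCommGroup E] [InnerProductSpace ℝ E] [Fintype H]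

lemma sum_prod_eq_one {q : H → ℝ} (hq : ∑ h, q h = 1) (m : ℕ) :
    ∑ h : Fin m → H, ∏ i, q (h i) = 1 := by
  classical
  have := Finset.prod_univ_sum (fun _ : Fin m => (Finset.univ : Finset H)) (fun _ h => q h)
  rw [Fintype.piFinset_univ] at this
  rw [← this, hq, Finset.prod_const_one]

lemma sum_prod_mul_norm_sq_sum {q : H → ℝ} (hq : ∑ h, q h = 1) {Z : H → E}
    (hZ : ∑ h, q h • Z h = 0) (m : ℕ) :
    ∑ h : Fin m → H, (∏ i, q (h i)) * ‖∑ i, Z (h i)‖ ^ 2 = m * ∑ h, q h * ‖Z h‖ ^ 2 := by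
  induction m with
  | zero => simp
  | succ m ih =>
    rw [← (Fin.consEquiv fun _ => H).sum_comp, Fintype.sum_prod_type, Finset.sum_comm]
    have h1 : ∀ h' : Fin m → H, ∑ h₀ : H,
        (∏ i, q ((Fin.consEquiv fun _ => H) (h₀, h') i)) *
          ‖∑ i, Z ((Fin.consEquiv fun _ => H) (h₀, h') i)‖ ^ 2 =
        (∏ i, q (h' i)) * ∑ h, q h * ‖Z h‖ ^ 2 + (∏ i, q (h' i)) * ‖∑ i, Z (h' i)‖ ^ 2 := by
      intro h'
      -- Independence of the first sample from the others: the cross term vanishes because `Z` is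
      -- centred.
      have h2 : ∑ h₀, q h₀ * inner ℝ (Z h₀) (∑ i, Z (h' i)) = 0 := by
        simp_rw [← real_inner_smul_left]
        rw [← sum_inner, hZ, inner_zero_left]
      calc _ = ∑ h₀, (∏ i, q (h' i)) * (q h₀ * ‖Z h₀‖ ^ 2 +
            2 * (q h₀ * inner ℝ (Z h₀) (∑ i, Z (h' i))) + q h₀ * ‖∑ i, Z (h' i)‖ ^ 2) := by
            refine Finset.sum_congr rfl fun h₀ _ => ?_
            simp only [Fin.consEquiv_apply, Fin.prod_univ_succ, Fin.sum_univ_succ, Fin.cons_zero,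
              Fin.cons_succ, norm_add_sq_real]
            ring
        _ = _ := by
            rw [← Finset.mul_sum, Finset.sum_add_distrib, Finset.sum_add_distrib,
              ← Finset.mul_sum, h2, ← Finset.sum_mul, hq]
            ring
    rw [Finset.sum_congr rfl fun h' _ => h1 h', Finset.sum_add_distrib, ih, ← Finset.sum_mul,
      sum_prod_eq_one hq]
    push_cast
    ring

/-- The mean squared error of the mean of `m` independent bounded vectors. -/
lemma sum_prod_mul_norm_sq_mean_sub_le {q : H → ℝ} (hq0 : ∀ h, 0 ≤ q h) (hq : ∑ h, q h = 1)
    {Y : H → E} {b : ℝ} (hY : ∀ h, ‖Y h‖ ≤ b) {m : ℕ} (hm : 1 ≤ m) :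
    ∑ h : Fin m → H, (∏ i, q (h i)) * ‖(m : ℝ)⁻¹ • ∑ i, Y (h i) - ∑ h, q h • Y h‖ ^ 2 ≤
      b ^ 2 / m := by
  have hm0 : (0 : ℝ) < m := by exact_mod_cast hm
  set μ := ∑ h, q h • Y h with hμ
  have hZ : ∑ h, q h • (Y h - μ) = 0 := by
    simp_rw [smul_sub]
    rw [Finset.sum_sub_distrib, ← Finset.sum_smul, hq, one_smul, ← hμ, sub_self]
  have h1 : ∀ h : Fin m → H, ‖(m : ℝ)⁻¹ • ∑ i, Y (h i) - μ‖ ^ 2 =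
      ((m : ℝ)⁻¹) ^ 2 * ‖∑ i, (Y (h i) - μ)‖ ^ 2 := by
    intro h
    rw [← mul_pow, ← Real.norm_of_nonneg (inv_nonneg.2 hm0.le), ← norm_smul,
      Real.norm_of_nonneg (inv_nonneg.2 hm0.le), Finset.sum_sub_distrib, smul_sub,
      Finset.sum_const, Finset.card_univ, Fintype.card_fin, ← Nat.cast_smul_eq_nsmul ℝ, smul_smul,
      inv_mul_cancel₀ hm0.ne', one_smul]
  -- The variance is at most the second moment.
  have h2 : ∑ h, q h * ‖Y h - μ‖ ^ 2 ≤ b ^ 2 := by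
    have h3 : ∀ h, q h * ‖Y h - μ‖ ^ 2 =
        q h * ‖Y h‖ ^ 2 - 2 * (q h * inner ℝ (Y h) μ) + q h * ‖μ‖ ^ 2 := by
      intro h
      rw [norm_sub_sq_real]
      ring
    have h4 : ∑ h, q h * inner ℝ (Y h) μ = ‖μ‖ ^ 2 := by
      simp_rw [← real_inner_smul_left]
      rw [← sum_inner, real_inner_self_eq_norm_sq]
    have h5 : ∑ h, q h * ‖Y h‖ ^ 2 ≤ ∑ h, q h * b ^ 2 := by
      gcongr with h
      · exact hq0 h
      · exact hY h
    rw [← Finset.sum_mul, hq] at h5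
    rw [Finset.sum_congr rfl fun h _ => h3 h, Finset.sum_add_distrib, Finset.sum_sub_distrib,
      ← Finset.mul_sum, h4, ← Finset.sum_mul, hq]
    nlinarith [sq_nonneg ‖μ‖]
  calc _ = ((m : ℝ)⁻¹) ^ 2 * ∑ h : Fin m → H, (∏ i, q (h i)) * ‖∑ i, (Y (h i) - μ)‖ ^ 2 := by
        rw [Finset.mul_sum]
        refine Finset.sum_congr rfl fun h _ => ?_
        rw [h1]
        ring
    _ = (∑ h, q h * ‖Y h - μ‖ ^ 2) / m := by
        rw [sum_prod_mul_norm_sq_sum hq hZ]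
        field_simp
    _ ≤ b ^ 2 / m := by gcongr

end Variance

/-! ### Integrals of functions of the sublevel set. -/

section StepIntegral

variable {E H : Type*} [NormedAddCommGroup E] [NormedSpace ℝ E] [CompleteSpace E] [Fintype H]

open Classical in
/-- The set of indices whose value is at most `x`. -/
noncomputable def sublevel (X : H → ℝ) (x : ℝ) : Finset H := Finset.univ.filter fun h => X h ≤ x

/-- The measure of the part of the interval `(a, b]` on which the sublevel set is `V`. -/
noncomputable def sublevelLength (X : H → ℝ) (a b : ℝ) (V : Finset H) : ℝ :=
  (volume.restrict (Set.Ioc a b)).real {x | sublevel X x = V}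

lemma sublevelLength_nonneg (X : H → ℝ) (a b : ℝ) (V : Finset H) : 0 ≤ sublevelLength X a b V :=
  measureReal_nonneg

lemma measurableSet_sublevel_eq (X : H → ℝ) (V : Finset H) :
    MeasurableSet {x | sublevel X x = V} := by
  have : {x | sublevel X x = V} = ⋂ h, {x | X h ≤ x ↔ h ∈ V} := by
    ext x; simp [sublevel, Finset.ext_iff]
  rw [this]
  refine .iInter fun h => ?_
  by_cases hV : h ∈ V
  · simp only [hV, iff_true]
    exact measurableSet_Ici
  · simp only [hV, iff_false, not_le]
    exact measurableSet_Iio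

/-- As `x` varies the sublevel set takes finitely many values, so the integrand is a step function.
-/
lemma intervalIntegral_sublevel (X : H → ℝ) {a b : ℝ} (hab : a ≤ b) (f : Finset H → E) :
    IntervalIntegrable (fun x => f (sublevel X x)) volume a b ∧
    ∫ x in a..b, f (sublevel X x) = ∑ V, sublevelLength X a b V • f V := by
  classical
  have h1 : (fun x => f (sublevel X x)) =
      fun x => ∑ V, Set.indicator {x | sublevel X x = V} (fun _ => f V) x := by
    funext x
    rw [Finset.sum_eq_single (sublevel X x)]
    · simp
    · intro V _ hV
      rw [Set.indicator_of_notMem]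
      exact fun h => hV h.symm
    · simp
  have hint : ∀ V ∈ Finset.univ, Integrable
      (fun x => Set.indicator {x | sublevel X x = V} (fun _ => f V) x)
      (volume.restrict (Set.Ioc a b)) := fun V _ =>
    (integrable_const (f V)).indicator (measurableSet_sublevel_eq X V)
  refine ⟨?_, ?_⟩
  · rw [intervalIntegrable_iff_integrableOn_Ioc_of_le hab, h1]
    exact integrable_finsetSum _ hint
  · rw [intervalIntegral.integral_of_le hab, h1, integral_finsetSum _ hint]
    refine Finset.sum_congr rfl fun V _ => ?_
    rw [integral_indicator_const _ (measurableSet_sublevel_eq X V)]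
    rfl

lemma sum_sublevelLength (X : H → ℝ) {a b : ℝ} (hab : a ≤ b) :
    ∑ V, sublevelLength X a b V = b - a := by
  have h := (intervalIntegral_sublevel X hab (fun _ => (1 : ℝ))).2
  simpa using h.symm

end StepIntegral

/-! ### The risk measure and its gradient on a finite space. -/

section FiniteRisk

variable {E H : Type*} [NormedAddCommGroup E] [InnerProductSpace ℝ E] [CompleteSpace E] [Fintype H]

/-- The probability of the event `V`. -/
def eventProb (p : E → H → ℝ) (θ : E) (V : Finset H) : ℝ := ∑ h ∈ V, p θ h

/-- The gradient of the probability of the event `V`, as an expectation of the score. -/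
def eventGrad (p : E → H → ℝ) (u : E → H → E) (θ : E) (V : Finset H) : E :=
  ∑ h ∈ V, p θ h • u θ h

/-- The distortion risk measure, up to an additive constant, as a weighted sum over events. -/
def finRisk (len : Finset H → ℝ) (g : ℝ → ℝ) (p : E → H → ℝ) (θ : E) : ℝ :=
  ∑ V, len V * g (1 - eventProb p θ V)

/-- The gradient of `finRisk`. -/
def finRiskGrad (len : Finset H → ℝ) (k : ℝ → ℝ) (p : E → H → ℝ) (u : E → H → E) (θ : E) : E :=
  -∑ V, len V • (k (1 - eventProb p θ V) • eventGrad p u θ V)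

namespace IsSmoothFamily

variable {p : E → H → ℝ} {u : E → H → E} {B C : ℝ}

lemma bound_nonneg (hp : IsSmoothFamily p u B C) : 0 ≤ B := by
  have h : (Finset.univ : Finset H).Nonempty := by
    by_contra hne
    have := hp.sum_eq_one 0
    rw [Finset.not_nonempty_iff_eq_empty.1 hne, Finset.sum_empty] at this
    exact zero_ne_one this
  obtain ⟨h, -⟩ := h
  exact (norm_nonneg _).trans (hp.norm_score_le 0 h)

lemma deriv_bound_nonneg (hp : IsSmoothFamily p u B C) : 0 ≤ C := by
  have h : (Finset.univ : Finset H).Nonempty := by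
    by_contra hne
    have := hp.sum_eq_one 0
    rw [Finset.not_nonempty_iff_eq_empty.1 hne, Finset.sum_empty] at this
    exact zero_ne_one this
  obtain ⟨h, -⟩ := h
  exact (norm_nonneg _).trans (hp.norm_fderiv_score_le 0 h)

lemma eventProb_univ (hp : IsSmoothFamily p u B C) (θ : E) :
    eventProb p θ Finset.univ = 1 := hp.sum_eq_one θ

lemma eventProb_nonneg (hp : IsSmoothFamily p u B C) (θ : E) (V : Finset H) :
    0 ≤ eventProb p θ V := Finset.sum_nonneg fun h _ => (hp.pos θ h).le

lemma eventProb_le_one (hp : IsSmoothFamily p u B C) (θ : E) (V : Finset H) :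
    eventProb p θ V ≤ 1 := by
  rw [← hp.sum_eq_one θ]
  exact Finset.sum_le_univ_sum_of_nonneg fun h => (hp.pos θ h).le

lemma one_sub_eventProb_mem_Icc (hp : IsSmoothFamily p u B C) (θ : E) (V : Finset H) :
    1 - eventProb p θ V ∈ Set.Icc (0 : ℝ) 1 :=
  ⟨by linarith [hp.eventProb_le_one θ V], by linarith [hp.eventProb_nonneg θ V]⟩

lemma one_sub_eventProb_mem_Ioo (hp : IsSmoothFamily p u B C) (θ : E) {V : Finset H}
    (hV : V.Nonempty) (hV' : V ≠ Finset.univ) : 1 - eventProb p θ V ∈ Set.Ioo (0 : ℝ) 1 := by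
  have h1 : 0 < eventProb p θ V := Finset.sum_pos (fun h _ => hp.pos θ h) hV
  have h2 : eventProb p θ V < 1 := by
    obtain ⟨h, hh⟩ : ∃ h, h ∉ V := by
      by_contra! hall
      exact hV' (Finset.eq_univ_iff_forall.2 hall)
    rw [← hp.sum_eq_one θ]
    exact Finset.sum_lt_sum_of_subset (Finset.subset_univ V) (Finset.mem_univ h) hh (hp.pos θ h)
      fun h _ _ => (hp.pos θ h).le
  exact ⟨by linarith, by linarith⟩

lemma hasGradientAt_eventProb (hp : IsSmoothFamily p u B C) (θ : E) (V : Finset H) :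
    HasGradientAt (fun ϑ => eventProb p ϑ V) (eventGrad p u θ V) θ := by
  rw [hasGradientAt_iff_hasFDerivAt, eventGrad, map_sum]
  exact HasFDerivAt.fun_sum fun h _ => (hp.hasGradientAt θ h).hasFDerivAt

/-- The total probability is constant in `θ`, so the mean score is zero. -/
lemma eventGrad_univ (hp : IsSmoothFamily p u B C) (θ : E) :
    eventGrad p u θ Finset.univ = 0 := by
  refine (hp.hasGradientAt_eventProb θ Finset.univ).unique ?_
  simp_rw [hp.eventProb_univ]
  exact hasGradientAt_const _ _

lemma norm_sum_smul_le (hp : IsSmoothFamily p u B C) {F : Type*} [NormedAddCommGroup F]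
    [NormedSpace ℝ F] (θ : E) (V : Finset H) {b : ℝ} {v : H → F} (hv : ∀ h, ‖v h‖ ≤ b)
    (hb : 0 ≤ b) : ‖∑ h ∈ V, p θ h • v h‖ ≤ b := by
  calc ‖∑ h ∈ V, p θ h • v h‖ ≤ ∑ h ∈ V, p θ h * b := by
        refine norm_sum_le_of_le _ fun h _ => ?_
        rw [norm_smul, Real.norm_of_nonneg (hp.pos θ h).le]
        exact mul_le_mul_of_nonneg_left (hv h) (hp.pos θ h).le
    _ = eventProb p θ V * b := by rw [eventProb, Finset.sum_mul]
    _ ≤ b := mul_le_of_le_one_left hb (hp.eventProb_le_one θ V)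

lemma norm_eventGrad_le (hp : IsSmoothFamily p u B C) (θ : E) (V : Finset H) :
    ‖eventGrad p u θ V‖ ≤ B :=
  hp.norm_sum_smul_le θ V (hp.norm_score_le θ) hp.bound_nonneg

lemma abs_eventProb_sub_le (hp : IsSmoothFamily p u B C) (θ θ' : E) (V : Finset H) :
    |eventProb p θ V - eventProb p θ' V| ≤ B * ‖θ - θ'‖ := by
  refine convex_univ.norm_image_sub_le_of_norm_hasFDerivWithin_le
    (f := fun ϑ => eventProb p ϑ V)
    (fun x _ => (hp.hasGradientAt_eventProb x V).hasFDerivAt.hasFDerivWithinAt) (fun x _ => ?_)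
    (Set.mem_univ θ') (Set.mem_univ θ)
  rw [LinearIsometryEquiv.norm_map]
  exact hp.norm_eventGrad_le x V

lemma norm_eventGrad_sub_le (hp : IsSmoothFamily p u B C) (θ θ' : E) (V : Finset H) :
    ‖eventGrad p u θ V - eventGrad p u θ' V‖ ≤ (B ^ 2 + C) * ‖θ - θ'‖ := by
  -- From `∇(p u) = p (∇u + u ⊗ u)`, which is where `B ^ 2 + C` comes from.
  let D : E → H → E →L[ℝ] E := fun x h => fderiv ℝ (fun ϑ => u ϑ h) x +
    (InnerProductSpace.toDual ℝ E (u x h)).smulRight (u x h)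
  have hD : ∀ x, HasFDerivAt (fun ϑ => eventGrad p u ϑ V) (∑ h ∈ V, p x h • D x h) x := by
    intro x
    refine HasFDerivAt.fun_sum fun h _ => ?_
    refine ((hp.hasGradientAt x h).hasFDerivAt.smul
      (hp.differentiable_score h x).hasFDerivAt).congr_fderiv ?_
    ext v
    simp [D, smul_smul]
  have hDn : ∀ x h, ‖D x h‖ ≤ B ^ 2 + C := by
    intro x h
    refine (norm_add_le _ _).trans ?_
    rw [ContinuousLinearMap.norm_smulRight_apply, LinearIsometryEquiv.norm_map, add_comm]
    refine add_le_add ?_ (hp.norm_fderiv_score_le x h)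
    rw [← sq]
    exact pow_le_pow_left₀ (norm_nonneg _) (hp.norm_score_le x h) 2
  refine convex_univ.norm_image_sub_le_of_norm_hasFDerivWithin_le
    (f := fun ϑ => eventGrad p u ϑ V) (fun x _ => (hD x).hasFDerivWithinAt) (fun x _ => ?_)
    (Set.mem_univ θ') (Set.mem_univ θ)
  exact hp.norm_sum_smul_le x V (hDn x) (add_nonneg (sq_nonneg _) hp.deriv_bound_nonneg)

variable {g k : ℝ → ℝ} {c c' : ℝ} {len : Finset H → ℝ}

/-- A proper nonempty event has probability strictly inside `(0, 1)`, where `g` is differentiable.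
For the empty and the full event the probability does not depend on `θ`, so the behaviour of `g` at
`1` and `0` plays no role. -/
lemma hasGradientAt_finRisk (hp : IsSmoothFamily p u B C) (hk : IsDistortionDeriv g k c c')
    (len : Finset H → ℝ) (θ : E) :
    HasGradientAt (finRisk len g p) (finRiskGrad len k p u θ) θ := by
  have h1 : ∀ V, HasGradientAt (fun ϑ => g (1 - eventProb p ϑ V))
      (-(k (1 - eventProb p θ V) • eventGrad p u θ V)) θ := by
    intro V
    rcases V.eq_empty_or_nonempty with rfl | hV
    · simp only [eventProb, eventGrad, Finset.sum_empty, smul_zero, neg_zero]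
      exact hasGradientAt_const _ _
    by_cases hV' : V = Finset.univ
    · subst hV'
      simp only [hp.eventProb_univ, hp.eventGrad_univ, smul_zero, neg_zero]
      exact hasGradientAt_const _ _
    have h2 := ((hp.hasGradientAt_eventProb θ V).hasFDerivAt).const_sub 1
    have h3 := (hk.hasDerivAt _ (hp.one_sub_eventProb_mem_Ioo θ hV hV')).comp_hasFDerivAt θ h2
    rw [hasGradientAt_iff_hasFDerivAt]
    refine h3.congr_fderiv ?_
    rw [map_neg, map_smul, smul_neg]
  rw [hasGradientAt_iff_hasFDerivAt]
  have h4 := HasFDerivAt.fun_sum (u := Finset.univ) fun V _ =>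
    ((h1 V).hasFDerivAt).const_mul (len V)
  refine h4.congr_fderiv ?_
  rw [finRiskGrad, map_neg, map_sum, ← Finset.sum_neg_distrib]
  refine Finset.sum_congr rfl fun V _ => ?_
  rw [map_smul, map_neg, smul_neg]

lemma norm_finRiskGrad_le (hp : IsSmoothFamily p u B C) (hk : IsDistortionDeriv g k c c')
    (hlen : ∀ V, 0 ≤ len V) (θ : E) :
    ‖finRiskGrad len k p u θ‖ ≤ (∑ V, len V) * (c * B) := by
  rw [finRiskGrad, norm_neg, Finset.sum_mul]
  refine norm_sum_le_of_le _ fun V _ => ?_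
  have h := hk.abs_le _ (hp.one_sub_eventProb_mem_Icc θ V)
  rw [norm_smul, norm_smul, Real.norm_of_nonneg (hlen V), Real.norm_eq_abs]
  exact mul_le_mul_of_nonneg_left (mul_le_mul h (hp.norm_eventGrad_le θ V) (norm_nonneg _)
    ((abs_nonneg _).trans h)) (hlen V)

lemma norm_finRiskGrad_sub_le (hp : IsSmoothFamily p u B C) (hk : IsDistortionDeriv g k c c')
    (hc' : 0 ≤ c') (hlen : ∀ V, 0 ≤ len V) (θ θ' : E) :
    ‖finRiskGrad len k p u θ - finRiskGrad len k p u θ'‖ ≤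
      ((∑ V, len V) * (c * (B ^ 2 + C) + c' * B ^ 2)) * ‖θ - θ'‖ := by
  rw [finRiskGrad, finRiskGrad, ← neg_add', ← sub_eq_add_neg, norm_neg, ← Finset.sum_sub_distrib,
    mul_assoc, Finset.sum_mul]
  refine norm_sum_le_of_le _ fun V _ => ?_
  rw [← smul_sub, norm_smul, Real.norm_of_nonneg (hlen V)]
  refine mul_le_mul_of_nonneg_left ?_ (hlen V)
  set a := 1 - eventProb p θ V with ha
  set a' := 1 - eventProb p θ' V with ha'
  have hsplit : k a • eventGrad p u θ V - k a' • eventGrad p u θ' V =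
      k a • (eventGrad p u θ V - eventGrad p u θ' V) + (k a - k a') • eventGrad p u θ' V := by
    module
  have h1 := hk.abs_le _ (hp.one_sub_eventProb_mem_Icc θ V)
  have h2 := hk.lipschitz a a'
  have h3 : |a - a'| ≤ B * ‖θ - θ'‖ := by
    rw [ha, ha', sub_sub_sub_cancel_left, norm_sub_rev]
    exact hp.abs_eventProb_sub_le θ' θ V
  have hB := hp.bound_nonneg
  rw [hsplit]
  refine (norm_add_le _ _).trans ?_
  rw [norm_smul, norm_smul, Real.norm_eq_abs, Real.norm_eq_abs]
  calc |k a| * ‖eventGrad p u θ V - eventGrad p u θ' V‖ + |k a - k a'| * ‖eventGrad p u θ' V‖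
      ≤ c * ((B ^ 2 + C) * ‖θ - θ'‖) + c' * (B * ‖θ - θ'‖) * B := by
        refine add_le_add (mul_le_mul h1 (hp.norm_eventGrad_sub_le θ θ' V) (norm_nonneg _)
          ((abs_nonneg _).trans h1)) (mul_le_mul (h2.trans ?_) (hp.norm_eventGrad_le θ' V)
          (norm_nonneg _) (by positivity))
        exact mul_le_mul_of_nonneg_left h3 hc'
    _ = _ := by ring

lemma abs_finRisk_le (hp : IsSmoothFamily p u B C) (hg : IsDistortion g)
    (hlen : ∀ V, 0 ≤ len V) (θ : E) : |finRisk len g p θ| ≤ ∑ V, len V := by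
  refine (Finset.abs_sum_le_sum_abs _ _).trans (Finset.sum_le_sum fun V _ => ?_)
  have h := hg.mapsTo (hp.one_sub_eventProb_mem_Icc θ V)
  rw [abs_mul, abs_of_nonneg (hlen V), abs_of_nonneg h.1]
  exact mul_le_of_le_one_right (hlen V) h.2

end IsSmoothFamily

end FiniteRisk

/-! ### The gradient estimator on a finite space and its error. -/

section FiniteEstimator

variable {E H : Type*} [NormedAddCommGroup E] [InnerProductSpace ℝ E] [CompleteSpace E]

/-- The empirical mean over the sample `h` of the vectors `v` on the event `V`. -/
noncomputable def eventMean {F : Type*} [AddCommGroup F] [Module ℝ F] {m : ℕ} (v : H → F) (h : Fin m → H)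
    (V : Finset H) : F :=
  (m : ℝ)⁻¹ • ∑ i, Set.indicator (V : Set H) v (h i)

lemma norm_eventMean_le {F : Type*} [NormedAddCommGroup F] [NormedSpace ℝ F] {m : ℕ} {v : H → F}
    {b : ℝ} (hb : 0 ≤ b) (hv : ∀ h, ‖v h‖ ≤ b) (h : Fin m → H) (V : Finset H) :
    ‖eventMean v h V‖ ≤ b := by
  have h1 : ‖∑ i, Set.indicator (V : Set H) v (h i)‖ ≤ ∑ _i : Fin m, b :=
    norm_sum_le_of_le _ fun i _ => (norm_indicator_le_norm_self _ _).trans (hv _)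
  rw [Finset.sum_const, Finset.card_univ, Fintype.card_fin, nsmul_eq_mul] at h1
  rw [eventMean, norm_smul, Real.norm_of_nonneg (by positivity)]
  rcases Nat.eq_zero_or_pos m with rfl | hm
  · simpa using hb
  · rw [inv_mul_le_iff₀ (by exact_mod_cast hm)]
    exact h1

lemma one_sub_eventMean_mem_Icc {m : ℕ} (h : Fin m → H) (V : Finset H) :
    1 - eventMean (fun _ => (1 : ℝ)) h V ∈ Set.Icc (0 : ℝ) 1 := by
  have h1 := norm_eventMean_le zero_le_one (v := fun _ : H => (1 : ℝ)) (by simp) h V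
  have h2 : 0 ≤ eventMean (fun _ => (1 : ℝ)) h V :=
    mul_nonneg (by positivity) (Finset.sum_nonneg fun i _ =>
      Set.indicator_nonneg (fun _ _ => zero_le_one) _)
  rw [Real.norm_of_nonneg h2] at h1
  exact ⟨by linarith, by linarith⟩

variable [Fintype H]

/-- The likelihood-ratio estimate of the gradient of `finRisk` from the sample `h`. -/
noncomputable def finEstimate (len : Finset H → ℝ) (k : ℝ → ℝ) (u : E → H → E) (θ : E) {m : ℕ}
    (h : Fin m → H) : E :=
  -∑ V, len V • (k (1 - eventMean (fun _ => (1 : ℝ)) h V) • eventMean (u θ) h V)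

namespace IsSmoothFamily

variable {p : E → H → ℝ} {u : E → H → E} {B C : ℝ} {g k : ℝ → ℝ} {c c' : ℝ} {len : Finset H → ℝ}

lemma norm_finEstimate_le (hp : IsSmoothFamily p u B C) (hk : IsDistortionDeriv g k c c')
    (hlen : ∀ V, 0 ≤ len V) (θ : E) {m : ℕ} (h : Fin m → H) :
    ‖finEstimate len k u θ h‖ ≤ (∑ V, len V) * (c * B) := by
  rw [finEstimate, norm_neg, Finset.sum_mul]
  refine norm_sum_le_of_le _ fun V _ => ?_
  have h1 := hk.abs_le _ (one_sub_eventMean_mem_Icc h V)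
  rw [norm_smul, norm_smul, Real.norm_of_nonneg (hlen V), Real.norm_eq_abs]
  exact mul_le_mul_of_nonneg_left (mul_le_mul h1
    (norm_eventMean_le hp.bound_nonneg (hp.norm_score_le θ) h V) (norm_nonneg _)
    ((abs_nonneg _).trans h1)) (hlen V)

lemma sum_norm_sq_eventMean_sub_le (hp : IsSmoothFamily p u B C) {F : Type*}
    [NormedAddCommGroup F] [InnerProductSpace ℝ F] (θ : E) (V : Finset H) {b : ℝ} {v : H → F}
    (hv : ∀ h, ‖v h‖ ≤ b) {m : ℕ} (hm : 1 ≤ m) :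
    ∑ h : Fin m → H, (∏ i, p θ (h i)) * ‖eventMean v h V - ∑ h ∈ V, p θ h • v h‖ ^ 2 ≤
      b ^ 2 / m := by
  classical
  have h1 := sum_prod_mul_norm_sq_mean_sub_le (fun h => (hp.pos θ h).le) (hp.sum_eq_one θ)
    (Y := Set.indicator (V : Set H) v) (b := b)
    (fun h => (norm_indicator_le_norm_self _ _).trans (hv h)) hm
  have h2 : ∑ h, p θ h • Set.indicator (V : Set H) v h = ∑ h ∈ V, p θ h • v h := by
    simp [Set.indicator_apply, Finset.sum_ite_mem]
  rw [h2] at h1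
  exact h1

/-- The mean squared error of the likelihood-ratio estimate of the gradient. -/
lemma sum_norm_sq_finEstimate_sub_le (hp : IsSmoothFamily p u B C)
    (hk : IsDistortionDeriv g k c c') (hc' : 0 ≤ c') (hlen : ∀ V, 0 ≤ len V) (θ : E) {m : ℕ}
    (hm : 1 ≤ m) :
    ∑ h : Fin m → H, (∏ i, p θ (h i)) * ‖finEstimate len k u θ h - finRiskGrad len k p u θ‖ ^ 2 ≤
      2 * (∑ V, len V) ^ 2 * B ^ 2 * (c ^ 2 + c' ^ 2) / m := by
  set Λ := ∑ V, len V with hΛ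
  have hΛ0 : 0 ≤ Λ := Finset.sum_nonneg fun V _ => hlen V
  have hB := hp.bound_nonneg
  let e : (Fin m → H) → Finset H → ℝ := fun h V =>
    ‖eventMean (u θ) h V - ∑ h ∈ V, p θ h • u θ h‖ ^ 2
  let e' : (Fin m → H) → Finset H → ℝ := fun h V =>
    ‖eventMean (fun _ => (1 : ℝ)) h V - ∑ h ∈ V, p θ h • (1 : ℝ)‖ ^ 2
  have hδ : ∀ (h : Fin m → H) V,
      ‖k (1 - eventMean (fun _ => (1 : ℝ)) h V) • eventMean (u θ) h V -
        k (1 - eventProb p θ V) • eventGrad p u θ V‖ ^ 2 ≤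
      2 * (c ^ 2 * e h V + c' ^ 2 * B ^ 2 * e' h V) := by
    intro h V
    set a := eventMean (fun _ => (1 : ℝ)) h V with ha
    set a' := eventProb p θ V with ha'
    -- Separates the error in the score mean (weight `c`) from the error in the empirical
    -- probability (weight `c' * B`).
    have hsplit : k (1 - a) • eventMean (u θ) h V - k (1 - a') • eventGrad p u θ V =
        k (1 - a) • (eventMean (u θ) h V - eventGrad p u θ V) +
          (k (1 - a) - k (1 - a')) • eventGrad p u θ V := by
      module
    have h1 := hk.abs_le _ (one_sub_eventMean_mem_Icc h V)
    have h2 : |k (1 - a) - k (1 - a')| ≤ c' * |a - a'| := by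
      refine (hk.lipschitz _ _).trans_eq ?_
      rw [sub_sub_sub_cancel_left, abs_sub_comm]
    have he' : e' h V = |a - a'| ^ 2 := by
      simp only [e', smul_eq_mul, mul_one, Real.norm_eq_abs]
      rfl
    have h3 : ‖k (1 - a) • eventMean (u θ) h V - k (1 - a') • eventGrad p u θ V‖ ≤
        c * ‖eventMean (u θ) h V - eventGrad p u θ V‖ + c' * |a - a'| * B := by
      rw [hsplit]
      refine (norm_add_le _ _).trans ?_
      rw [norm_smul, norm_smul, Real.norm_eq_abs, Real.norm_eq_abs]
      exact add_le_add (mul_le_mul_of_nonneg_right h1 (norm_nonneg _))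
        (mul_le_mul h2 (hp.norm_eventGrad_le θ V) (norm_nonneg _) (by positivity))
    refine (pow_le_pow_left₀ (norm_nonneg _) h3 2).trans ?_
    rw [he']
    refine (add_sq_le).trans_eq ?_
    simp only [e, eventGrad]
    ring
  -- Cauchy–Schwarz with weights `len`, so that only the error for each single event has to be
  -- averaged.
  have hcs : ∀ h : Fin m → H, ‖finEstimate len k u θ h - finRiskGrad len k p u θ‖ ^ 2 ≤
      Λ * ∑ V, len V * (2 * (c ^ 2 * e h V + c' ^ 2 * B ^ 2 * e' h V)) := by
    intro h
    rw [finEstimate, finRiskGrad, ← neg_add', ← sub_eq_add_neg, norm_neg,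
      ← Finset.sum_sub_distrib]
    simp_rw [← smul_sub]
    have h1 : ‖∑ V, len V • (k (1 - eventMean (fun _ => (1 : ℝ)) h V) • eventMean (u θ) h V -
        k (1 - eventProb p θ V) • eventGrad p u θ V)‖ ≤
        ∑ V, len V * ‖k (1 - eventMean (fun _ => (1 : ℝ)) h V) • eventMean (u θ) h V -
        k (1 - eventProb p θ V) • eventGrad p u θ V‖ := by
      refine norm_sum_le_of_le _ fun V _ => ?_
      rw [norm_smul, Real.norm_of_nonneg (hlen V)]
    refine (pow_le_pow_left₀ (norm_nonneg _) h1 2).trans ?_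
    refine (Finset.sum_sq_le_sum_mul_sum_of_sq_le_mul Finset.univ (fun V _ => hlen V)
      (fun V _ => mul_nonneg (hlen V) (sq_nonneg _)) (fun V _ => ?_)).trans
      (mul_le_mul_of_nonneg_left (Finset.sum_le_sum fun V _ =>
        mul_le_mul_of_nonneg_left (hδ h V) (hlen V)) hΛ0)
    exact le_of_eq (by ring)
  have hE : ∀ V, ∑ h : Fin m → H, (∏ i, p θ (h i)) * e h V ≤ B ^ 2 / m := fun V =>
    hp.sum_norm_sq_eventMean_sub_le θ V (hp.norm_score_le θ) hm
  have hE' : ∀ V, ∑ h : Fin m → H, (∏ i, p θ (h i)) * e' h V ≤ 1 ^ 2 / m := fun V =>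
    hp.sum_norm_sq_eventMean_sub_le θ V (by simp) hm
  calc _ ≤ ∑ h : Fin m → H, (∏ i, p θ (h i)) *
        (Λ * ∑ V, len V * (2 * (c ^ 2 * e h V + c' ^ 2 * B ^ 2 * e' h V))) :=
        Finset.sum_le_sum fun h _ => mul_le_mul_of_nonneg_left (hcs h)
          (Finset.prod_nonneg fun i _ => (hp.pos θ _).le)
    _ = Λ * ∑ V, len V * (2 * (c ^ 2 * ∑ h : Fin m → H, (∏ i, p θ (h i)) * e h V +
          c' ^ 2 * B ^ 2 * ∑ h : Fin m → H, (∏ i, p θ (h i)) * e' h V)) := by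
        simp_rw [Finset.mul_sum, ← Finset.sum_add_distrib, Finset.mul_sum]
        rw [Finset.sum_comm]
        refine Finset.sum_congr rfl fun V _ => Finset.sum_congr rfl fun h _ => ?_
        ring
    _ ≤ Λ * ∑ V, len V * (2 * (c ^ 2 * (B ^ 2 / m) + c' ^ 2 * B ^ 2 * (1 ^ 2 / m))) := by
        refine mul_le_mul_of_nonneg_left (Finset.sum_le_sum fun V _ =>
          mul_le_mul_of_nonneg_left ?_ (hlen V)) hΛ0
        have := hE V
        have := hE' V
        gcongr
    _ = _ := by
        rw [← Finset.sum_mul, ← hΛ]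
        ring

end IsSmoothFamily

end FiniteEstimator

/-! ### Transfer between episodes and the finite model. -/

section Reduction

variable {S A H : Type*} {d : ℕ} [Finite S] [Finite A]
  [MeasurableSpace S] [MeasurableSpace A]
  [MeasurableSingletonClass S] [MeasurableSingletonClass A]

lemma EpisodicMDP.rewardBound_pos {S A : Type*} (M : EpisodicMDP S A) : 0 < M.rewardBound :=
  div_pos M.rMax_pos (by linarith [M.γ_lt_one])

instance (M : EpisodicMDP S A) (π : Policy d S A) (m : ℕ) (θ : Param d) :
    IsProbabilityMeasure (batchLaw M π m θ) := by
  unfold batchLaw; infer_instance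

/-- The batches whose `i`-th episode belongs to the event `K (h i)`. -/
def batchEvent {T : Type*} (K : H → Set T) {m : ℕ} (h : Fin m → H) : Set (Fin m → T) :=
  Set.univ.pi fun i => K (h i)

namespace IsEpisodePartition

variable {M : EpisodicMDP S A} {π : Policy d S A} {K : H → Set (Trajectory S A)} {X : H → ℝ}
  {p : Param d → H → ℝ} {u : Param d → H → Param d} {B C : ℝ} {g k : ℝ → ℝ} {c c' : ℝ}

lemma measurableSet_batchEvent (hK : IsEpisodePartition M π K X p u) {m : ℕ} (h : Fin m → H) :
    MeasurableSet (batchEvent K h) :=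
  MeasurableSet.univ_pi fun i => hK.measurableSet (h i)

variable [Fintype H]

lemma rewardCDF_eq (hK : IsEpisodePartition M π K X p u) (hp : IsSmoothFamily p u B C)
    (θ : Param d) (x : ℝ) : rewardCDF M π θ x = eventProb p θ (sublevel X x) := by
  have hlaw : ∀ V : Finset H, episodeLaw M π θ (⋃ h ∈ V, K h) =
      ENNReal.ofReal (eventProb p θ V) := by
    intro V
    rw [measure_biUnion_finset (fun h _ h' _ hne => hK.disjoint hne)
      fun h _ => hK.measurableSet h, eventProb,
      ENNReal.ofReal_sum_of_nonneg fun h _ => (hp.pos θ h).le]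
    exact Finset.sum_congr rfl fun h _ => hK.law θ h
  have hcover : ∀ᵐ ω ∂(episodeLaw M π θ), ω ∈ ⋃ h ∈ (Finset.univ : Finset H), K h := by
    refine (mem_ae_iff_prob_eq_one
      (Finset.measurableSet_biUnion _ fun h _ => hK.measurableSet h)).2 ?_
    rw [hlaw, hp.eventProb_univ, ENNReal.ofReal_one]
  have hae : {ω | cumReward M ω ≤ x} =ᵐ[episodeLaw M π θ] ⋃ h ∈ sublevel X x, K h := by
    refine Filter.eventuallyEq_set.2 ?_
    filter_upwards [hcover] with ω hω
    simp only [Set.mem_iUnion, Finset.mem_univ, exists_true_left] at hω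
    obtain ⟨h, hh⟩ := hω
    refine ⟨fun hx => ?_, fun hx => ?_⟩
    · rw [hK.reward h ω hh] at hx
      exact Set.mem_iUnion₂.2 ⟨h, by simpa [sublevel] using hx, hh⟩
    · obtain ⟨h', hh', hω'⟩ := Set.mem_iUnion₂.1 hx
      rw [hK.reward h' ω hω']
      simpa [sublevel] using hh'
  rw [rewardCDF, measureReal_def, measure_congr hae, hlaw,
    ENNReal.toReal_ofReal (hp.eventProb_nonneg θ _)]

/-- The `-1` in the integral over `[-M_r, 0]` contributes `-M_r`; the rest is one integral over
`[-M_r, M_r]`. -/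
lemma drm_eq (hK : IsEpisodePartition M π K X p u) (hp : IsSmoothFamily p u B C)
    (g : ℝ → ℝ) (θ : Param d) :
    drm M π g θ =
      finRisk (sublevelLength X (-M.rewardBound) M.rewardBound) g p θ - M.rewardBound := by
  have hM := M.rewardBound_pos
  have h1 := intervalIntegral_sublevel X (a := -M.rewardBound) (b := 0) (by linarith)
    fun V => g (1 - eventProb p θ V)
  have h2 := intervalIntegral_sublevel X (a := 0) (b := M.rewardBound) hM.le
    fun V => g (1 - eventProb p θ V)
  have h3 := intervalIntegral_sublevel X (a := -M.rewardBound) (b := M.rewardBound) (by linarith)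
    fun V => g (1 - eventProb p θ V)
  rw [drm]
  simp_rw [hK.rewardCDF_eq hp]
  rw [intervalIntegral.integral_sub h1.1 intervalIntegrable_const, intervalIntegral.integral_const,
    finRisk, sub_add_eq_add_sub, intervalIntegral.integral_add_adjacent_intervals h1.1 h2.1, h3.2]
  simp

lemma gradEstimate_eq (hK : IsEpisodePartition M π K X p u)
    (hk : IsDistortionDeriv g k c c') (θ : Param d) {m : ℕ} {h : Fin m → H}
    {w : Fin m → Trajectory S A} (hw : w ∈ batchEvent K h) :
    gradEstimate M π g θ w =
      finEstimate (sublevelLength X (-M.rewardBound) M.rewardBound) k u θ h := by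
  have hM := M.rewardBound_pos
  have hwi : ∀ i, w i ∈ K (h i) := fun i => hw i trivial
  have hmem : ∀ x i, w i ∈ {ω | cumReward M ω ≤ x} ↔ h i ∈ (sublevel X x : Set H) := by
    intro x i
    rw [Set.mem_ofPred_eq, hK.reward _ _ (hwi i)]
    simp [sublevel]
  have hemp : ∀ x, empCDF M w x = eventMean (fun _ => (1 : ℝ)) h (sublevel X x) := by
    intro x
    rw [empCDF, eventMean, smul_eq_mul]
    congr 1
    refine Finset.sum_congr rfl fun i _ => ?_
    classical
    rw [Set.indicator_apply, Set.indicator_apply]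
    simp only [hmem]
  have hgrad : ∀ x, gradEmpCDF M π θ w x = eventMean (u θ) h (sublevel X x) := by
    intro x
    rw [gradEmpCDF, eventMean]
    congr 1
    refine Finset.sum_congr rfl fun i _ => ?_
    classical
    rw [Set.indicator_apply, Set.indicator_apply, hK.score θ _ _ (hwi i)]
    simp only [hmem]
  have hint : ∀ x, derivWithin g (Set.Icc 0 1) (1 - empCDF M w x) • gradEmpCDF M π θ w x =
      k (1 - eventMean (fun _ => (1 : ℝ)) h (sublevel X x)) • eventMean (u θ) h (sublevel X x) := by
    intro x
    rw [hemp, hgrad]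
    have hIcc := one_sub_eventMean_mem_Icc h (sublevel X x)
    rcases hIcc.2.lt_or_eq with hlt | heq
    · rw [hk.derivWithin_eq _ ⟨hIcc.1, hlt⟩]
    -- At the argument `1` the functions `derivWithin g` and `k` may differ, but then no sample lies
    -- in the event and the score mean vanishes.
    · have hzero : eventMean (u θ) h (sublevel X x) = 0 := by
        have h0 : eventMean (fun _ => (1 : ℝ)) h (sublevel X x) = 0 := by linarith
        rcases Nat.eq_zero_or_pos m with rfl | hm
        · simp [eventMean]
        rw [eventMean, smul_eq_zero_iff_right (by positivity),
          Finset.sum_eq_zero_iff_of_nonneg fun i _ =>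
            Set.indicator_nonneg (fun _ _ => zero_le_one) _] at h0
        rw [eventMean, Finset.sum_eq_zero, smul_zero]
        intro i hi
        refine Set.indicator_of_notMem (fun hmem => ?_) _
        have h1 := h0 i hi
        rw [Set.indicator_of_mem hmem] at h1
        exact one_ne_zero h1
      rw [hzero, smul_zero, smul_zero]
  rw [gradEstimate, finEstimate]
  simp_rw [hint]
  rw [(intervalIntegral_sublevel X (by linarith) fun V =>
    k (1 - eventMean (fun _ => (1 : ℝ)) h V) • eventMean (u θ) h V).2]

lemma batchLaw_batchEvent (hK : IsEpisodePartition M π K X p u) (hp : IsSmoothFamily p u B C)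
    (θ : Param d) {m : ℕ} (h : Fin m → H) :
    batchLaw M π m θ (batchEvent K h) = ENNReal.ofReal (∏ i, p θ (h i)) := by
  rw [batchLaw, batchEvent, Measure.pi_pi, ENNReal.ofReal_prod_of_nonneg fun i _ => (hp.pos θ _).le]
  exact Finset.prod_congr rfl fun i _ => hK.law θ (h i)

lemma batchLaw_iUnion_batchEvent (hK : IsEpisodePartition M π K X p u)
    (hp : IsSmoothFamily p u B C) (θ : Param d) (m : ℕ) :
    batchLaw M π m θ (⋃ h : Fin m → H, batchEvent K h) = 1 := by
  rw [measure_iUnion _ hK.measurableSet_batchEvent, tsum_fintype]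
  · simp_rw [hK.batchLaw_batchEvent hp]
    rw [← ENNReal.ofReal_sum_of_nonneg fun h _ => Finset.prod_nonneg fun i _ => (hp.pos θ _).le,
      sum_prod_eq_one (hp.sum_eq_one θ), ENNReal.ofReal_one]
  · intro h h' hne
    obtain ⟨i, hi⟩ := Function.ne_iff.1 hne
    rw [Function.onFun, Set.disjoint_left]
    exact fun w hw hw' => Set.disjoint_left.1 (hK.disjoint hi) (hw i trivial) (hw' i trivial)

end IsEpisodePartition

end Reduction

/-! ### Conditioning, the random output index, and stochastic ascent. -/

section Ascent

variable {Ω : Type*} [mΩ : MeasurableSpace Ω] {P : Measure Ω}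

/-- The hypothesis says that `q` is the conditional probability of `D` given `m₀`. The measures
`P.restrict D` and `P.withDensity q` then agree on `m₀`, hence integrate `m₀`-measurable functions
alike. -/
lemma setLIntegral_eq_lintegral_mul_of_forall_measure {m₀ : MeasurableSpace Ω} (hm : m₀ ≤ mΩ)
    {D : Set Ω} {q Z : Ω → ℝ≥0∞} (hq : Measurable[m₀] q)
    (hZ : Measurable[m₀] Z)
    (h : ∀ F : Set Ω, MeasurableSet[m₀] F → P (F ∩ D) = ∫⁻ ω in F, q ω ∂P) :
    ∫⁻ ω in D, Z ω ∂P = ∫⁻ ω, q ω * Z ω ∂P := by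
  have htrim : (P.restrict D).trim hm = (P.withDensity q).trim hm := by
    refine @Measure.ext Ω m₀ _ _ fun F hF => ?_
    rw [trim_measurableSet_eq hm hF, trim_measurableSet_eq hm hF,
      Measure.restrict_apply (hm F hF), withDensity_apply _ (hm F hF), h F hF]
  rw [← lintegral_trim hm hZ, htrim, lintegral_trim hm hZ,
    lintegral_withDensity_eq_lintegral_mul P (hq.mono hm le_rfl) (hZ.mono hm le_rfl)]
  rfl

/-- The law of the value of a process at a uniformly distributed independent time. -/
lemma integral_uniform_index {E : Type*} [MeasurableSpace E] [IsProbabilityMeasure P] {N : ℕ} (hN : 1 ≤ N) {θ : ℕ → Ω → E}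
    (hθ : ∀ k ≤ N, Measurable (θ k)) {R : Ω → ℕ} (hR : Measurable R)
    (hunif : ∀ k ∈ Finset.Icc 1 N, P (R ⁻¹' {k}) = (N : ℝ≥0∞)⁻¹)
    (hindep : IndepFun R (fun ω (k : Fin N) => θ (k + 1) ω) P)
    {φ : E → ℝ} (hφ : Measurable φ) {b : ℝ} (hb : ∀ x, |φ x| ≤ b) :
    Integrable (fun ω => φ (θ (R ω) ω)) P ∧
      ∫ ω, φ (θ (R ω) ω) ∂P = (N : ℝ)⁻¹ * ∑ k ∈ Finset.Icc 1 N, ∫ ω, φ (θ k ω) ∂P := by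
  let I : ℕ → ℕ → ℝ := fun k => Set.indicator {k} (fun _ => 1)
  have hI : ∀ k, Measurable fun ω => I k (R ω) := fun k =>
    (measurable_of_countable (I k)).comp hR
  have hφm : ∀ k ∈ Finset.Icc 1 N, Measurable fun ω => φ (θ k ω) := fun k hk =>
    hφ.comp (hθ k (Finset.mem_Icc.1 hk).2)
  have hmem : ∀ᵐ ω ∂P, R ω ∈ Finset.Icc 1 N := by
    have hset : {ω | R ω ∈ Finset.Icc 1 N} = ⋃ k ∈ Finset.Icc 1 N, R ⁻¹' {k} := by
      ext ω; simp
    refine (mem_ae_iff_prob_eq_one (s := {ω | R ω ∈ Finset.Icc 1 N}) ?_).2 ?_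
    · rw [hset]
      exact Finset.measurableSet_biUnion _ fun k _ => hR (measurableSet_singleton k)
    · rw [hset, measure_biUnion_finset, Finset.sum_congr rfl hunif, Finset.sum_const,
        Nat.card_Icc, add_tsub_cancel_right, nsmul_eq_mul, ENNReal.mul_inv_cancel]
      · exact_mod_cast (by omega : N ≠ 0)
      · exact ENNReal.natCast_ne_top N
      · intro k _ k' _ hne
        exact Set.disjoint_left.2 fun ω h h' => hne (Eq.trans (Eq.symm h) h')
      · exact fun k _ => hR (measurableSet_singleton k)
  have hae : (fun ω => φ (θ (R ω) ω)) =ᵐ[P]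
      fun ω => ∑ k ∈ Finset.Icc 1 N, I k (R ω) * φ (θ k ω) := by
    filter_upwards [hmem] with ω hω
    rw [Finset.sum_eq_single_of_mem _ hω fun k _ hk => by
      rw [show I k (R ω) = 0 from Set.indicator_of_notMem (by simpa using hk.symm) _, zero_mul]]
    simp [I]
  have hterm : ∀ k ∈ Finset.Icc 1 N, Integrable (fun ω => I k (R ω) * φ (θ k ω)) P := by
    intro k hk
    refine Integrable.of_bound ((hI k).mul (hφm k hk)).aestronglyMeasurable b
      (ae_of_all _ fun ω => ?_)
    rw [norm_mul, Real.norm_eq_abs, Real.norm_eq_abs]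
    refine (mul_le_of_le_one_left (abs_nonneg _) ?_).trans (hb _)
    by_cases h : R ω = k <;> simp [I, h]
  refine ⟨(integrable_finsetSum _ hterm).congr hae.symm, ?_⟩
  rw [integral_congr_ae hae, integral_finsetSum _ hterm, Finset.mul_sum]
  refine Finset.sum_congr rfl fun k hk => ?_
  obtain ⟨hk1, hkN⟩ := Finset.mem_Icc.1 hk
  have hind : IndepFun (fun ω => I k (R ω)) (fun ω => φ (θ k ω)) P := by
    -- The iterates `1, …, N` are indexed by `Fin N`, hence the shift `k - 1`.
    have h := hindep.comp (φ := I k) (ψ := fun x : Fin N → E => φ (x ⟨k - 1, by omega⟩))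
      (measurable_of_countable _) (hφ.comp (measurable_pi_apply _))
    have hk' : k - 1 + 1 = k := by omega
    simpa only [Function.comp_def, hk'] using h
  rw [hind.integral_fun_mul_eq_mul_integral (hI k).aestronglyMeasurable
    (hφm k hk).aestronglyMeasurable]
  congr 1
  have hII : (fun ω => I k (R ω)) = Set.indicator (R ⁻¹' {k}) fun _ => (1 : ℝ) := by
    funext ω
    by_cases h : R ω = k <;> simp [I, h]
  rw [hII, integral_indicator_const _ (hR (measurableSet_singleton k)), measureReal_def,
    hunif k hk]
  simp

/-- The sum of the squared gradient norms along gradient ascent with bounded errors. -/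
lemma sum_le_of_ascent {F s : ℕ → ℝ} {N : ℕ} (hN : 1 ≤ N) {b r a : ℝ} (ha : 0 ≤ a)
    (hs : 0 ≤ s 0) (hstep : ∀ k < N, F k + a * s k - r ≤ F (k + 1))
    (hlast : a * s N ≤ b - F N) :
    a * ∑ k ∈ Finset.Icc 1 N, s k ≤ b - F 0 + N * r := by
  -- The term `s 0` is dropped at the start of the induction because it is nonnegative.
  have h : ∀ j, j < N → F 0 + a * ∑ k ∈ Finset.Icc 1 j, s k - (j + 1) * r ≤ F (j + 1) := by
    intro j
    induction j with
    | zero =>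
      intro hj
      have := hstep 0 hj
      have := mul_nonneg ha hs
      simp
      linarith
    | succ j ih =>
      intro hj
      have h1 := ih (by omega)
      have h2 := hstep (j + 1) hj
      rw [Finset.sum_Icc_succ_top (by omega), mul_add]
      push_cast
      linarith
  obtain ⟨j, rfl⟩ : ∃ j, N = j + 1 := ⟨N - 1, by omega⟩
  have h1 := h j (by omega)
  rw [Finset.sum_Icc_succ_top (by omega), mul_add]
  push_cast
  linarith

variable {E : Type*} [NormedAddCommGroup E] [InnerProductSpace ℝ E] [CompleteSpace E]
  [MeasurableSpace E] [BorelSpace E] [SecondCountableTopology E]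

/-- One step of gradient ascent in expectation, with step-size `α` and a gradient estimate `e`
with norm bounded by `G` and mean squared error at most `σ`. -/
lemma integral_le_integral_gradient_step [IsProbabilityMeasure P] {f : E → ℝ} {f' : E → E}
    {L b : ℝ} (hL0 : 0 ≤ L)
    (hf : ∀ x, HasGradientAt f (f' x) x) (hL : ∀ x y, ‖f' x - f' y‖ ≤ L * ‖x - y‖)
    (hb : ∀ x, |f x| ≤ b) {G G' σ α : ℝ} (hα : 0 < α) (hG' : ∀ x, ‖f' x‖ ≤ G')
    (hf' : Continuous f') {x e : Ω → E} (hx : Measurable x) (he : Measurable e)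
    (heG : ∀ᵐ ω ∂P, ‖e ω‖ ≤ G) (hσ : 0 ≤ σ)
    (heσ : ∫⁻ ω, ENNReal.ofReal (‖e ω - f' (x ω)‖ ^ 2) ∂P ≤ ENNReal.ofReal σ) :
    ∫ ω, f (x ω) ∂P + α / 2 * ∫ ω, ‖f' (x ω)‖ ^ 2 ∂P - (α / 2 * σ + L / 2 * α ^ 2 * G ^ 2) ≤
      ∫ ω, f (x ω + α • e ω) ∂P := by
  have hfm : Measurable f :=
    (continuous_iff_continuousAt.2 fun x => (hf x).continuousAt).measurable
  have hint : ∀ {y : Ω → E}, Measurable y → Integrable (fun ω => f (y ω)) P := fun hy =>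
    Integrable.of_bound (hfm.comp hy).aestronglyMeasurable b (ae_of_all _ fun ω => hb _)
  have hint2 : Integrable (fun ω => ‖f' (x ω)‖ ^ 2) P := by
    refine Integrable.of_bound ((hf'.measurable.comp hx).norm.pow_const 2).aestronglyMeasurable
      (G' ^ 2) (ae_of_all _ fun ω => ?_)
    rw [Real.norm_of_nonneg (sq_nonneg _)]
    exact pow_le_pow_left₀ (norm_nonneg _) (hG' _) 2
  have hm3 : Measurable fun ω => ‖e ω - f' (x ω)‖ ^ 2 :=
    (he.sub (hf'.measurable.comp hx)).norm.pow_const 2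
  have hint3 : Integrable (fun ω => ‖e ω - f' (x ω)‖ ^ 2) P := by
    refine ⟨hm3.aestronglyMeasurable, ?_⟩
    rw [hasFiniteIntegral_iff_ofReal (ae_of_all _ fun ω => sq_nonneg _)]
    exact heσ.trans_lt ENNReal.ofReal_lt_top
  have hI3 : ∫ ω, ‖e ω - f' (x ω)‖ ^ 2 ∂P ≤ σ := by
    rw [integral_eq_lintegral_of_nonneg_ae (ae_of_all _ fun ω => sq_nonneg _)
      hm3.aestronglyMeasurable]
    exact ENNReal.toReal_le_of_le_ofReal hσ heσ
  have hstep : ∀ᵐ ω ∂P, f (x ω) + α / 2 * ‖f' (x ω)‖ ^ 2 - α / 2 * ‖e ω - f' (x ω)‖ ^ 2 -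
      L / 2 * α ^ 2 * G ^ 2 ≤ f (x ω + α • e ω) := by
    filter_upwards [heG] with ω hω
    have h1 := le_of_lipschitz_gradient hf hL (x ω) (α • e ω)
    rw [inner_smul_right, norm_smul, Real.norm_of_nonneg hα.le, mul_pow] at h1
    have h2 := norm_sub_sq_real (e ω) (f' (x ω))
    rw [real_inner_comm] at h2
    have h3 : ‖e ω‖ ^ 2 ≤ G ^ 2 := pow_le_pow_left₀ (norm_nonneg _) hω 2
    have h4 : L / 2 * (α ^ 2 * ‖e ω‖ ^ 2) ≤ L / 2 * (α ^ 2 * G ^ 2) := by gcongr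
    -- The `‖e‖²` term produced by polarization is nonnegative and is discarded.
    have h5 : 0 ≤ α / 2 * ‖e ω‖ ^ 2 := by positivity
    have h6 : α / 2 * ‖e ω - f' (x ω)‖ ^ 2 = α / 2 * ‖e ω‖ ^ 2 -
        α * inner ℝ (f' (x ω)) (e ω) + α / 2 * ‖f' (x ω)‖ ^ 2 := by
      rw [h2]; ring
    linarith
  have hA : Integrable (fun ω => f (x ω) + α / 2 * ‖f' (x ω)‖ ^ 2) P :=
    (hint hx).add (hint2.const_mul (α / 2))
  have hB : Integrable (fun ω => f (x ω) + α / 2 * ‖f' (x ω)‖ ^ 2 -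
      α / 2 * ‖e ω - f' (x ω)‖ ^ 2) P := hA.sub (hint3.const_mul (α / 2))
  have hC : Integrable (fun ω => f (x ω) + α / 2 * ‖f' (x ω)‖ ^ 2 -
      α / 2 * ‖e ω - f' (x ω)‖ ^ 2 - L / 2 * α ^ 2 * G ^ 2) P := hB.sub (integrable_const _)
  have hy : Measurable fun ω => x ω + α • e ω := hx.add (he.const_smul α)
  have hle := integral_mono_ae hC (hint hy) hstep
  rw [integral_sub hB (integrable_const _), integral_sub hA (hint3.const_mul (α / 2)),
    integral_add (hint hx) (hint2.const_mul (α / 2)), integral_const_mul, integral_const_mul,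
    integral_const, probReal_univ, one_smul] at hle
  have h7 : α / 2 * ∫ ω, ‖e ω - f' (x ω)‖ ^ 2 ∂P ≤ α / 2 * σ := by gcongr
  linarith

end Ascent

/-! ### Error of the gradient estimates along a run. -/

section Run

variable {S A H : Type*} {d : ℕ} [Finite S] [Finite A]
  [MeasurableSpace S] [MeasurableSpace A]
  [MeasurableSingletonClass S] [MeasurableSingletonClass A] [Fintype H]
  {M : EpisodicMDP S A} {π : Policy d S A} {g k : ℝ → ℝ} {N m : ℕ} {α : ℝ} {θ₀ : Param d}
  {Ω : Type*} [mΩ : MeasurableSpace Ω] {P : Measure Ω} [IsProbabilityMeasure P]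
  {ℱ : Filtration ℕ mΩ} {W : ℕ → Ω → Fin m → Trajectory S A} {θ : ℕ → Ω → Param d} {R : Ω → ℕ}
  {K : H → Set (Trajectory S A)} {X : H → ℝ}
  {p : Param d → H → ℝ} {u : Param d → H → Param d} {B C c c' : ℝ}

namespace IsRun

lemma ae_mem_batchEvent (hrun : IsRun M π g N m α θ₀ P ℱ W θ R)
    (hK : IsEpisodePartition M π K X p u) (hp : IsSmoothFamily p u B C) {j : ℕ} (hj : j < N) :
    ∀ᵐ ω ∂P, ∃ h : Fin m → H, W j ω ∈ batchEvent K h := by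
  have hms : MeasurableSet (⋃ h : Fin m → H, batchEvent K h) :=
    .iUnion fun h => hK.measurableSet_batchEvent h
  have h1 := hrun.batch_law j hj Set.univ MeasurableSet.univ _ hms
  simp_rw [hK.batchLaw_iUnion_batchEvent hp] at h1
  rw [Set.univ_inter, Measure.restrict_univ, lintegral_one, measure_univ] at h1
  have h2 : W j ⁻¹' (⋃ h : Fin m → H, batchEvent K h) ∈ ae P :=
    (mem_ae_iff_prob_eq_one (((hrun.measurable_batch j hj).mono (ℱ.le _) le_rfl) hms)).2 h1
  filter_upwards [h2] with ω hω
  exact Set.mem_iUnion.1 hω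

lemma ae_norm_gradEstimate_le (hrun : IsRun M π g N m α θ₀ P ℱ W θ R)
    (hK : IsEpisodePartition M π K X p u) (hp : IsSmoothFamily p u B C)
    (hk : IsDistortionDeriv g k c c') {j : ℕ} (hj : j < N) :
    ∀ᵐ ω ∂P, ‖gradEstimate M π g (θ j ω) (W j ω)‖ ≤ 2 * M.rewardBound * (c * B) := by
  filter_upwards [hrun.ae_mem_batchEvent hK hp hj] with ω ⟨h, hω⟩
  rw [hK.gradEstimate_eq hk _ hω]
  refine (hp.norm_finEstimate_le hk (fun V => sublevelLength_nonneg _ _ _ V) _ h).trans_eq ?_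
  rw [sum_sublevelLength X (by linarith [M.rewardBound_pos])]
  ring

/-- On each batch event the error is a function of the current iterate alone, hence determined by
the past. Averaging with the conditional probabilities of these events reduces the claim to the
finite bound at a frozen parameter. -/
lemma lintegral_norm_sq_gradEstimate_sub_le (hrun : IsRun M π g N m α θ₀ P ℱ W θ R)
    (hK : IsEpisodePartition M π K X p u) (hp : IsSmoothFamily p u B C)
    (hk : IsDistortionDeriv g k c c') (hc' : 0 ≤ c') (hm : 1 ≤ m) {j : ℕ} (hj : j < N) :
    ∫⁻ ω, ENNReal.ofReal (‖gradEstimate M π g (θ j ω) (W j ω) -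
        finRiskGrad (sublevelLength X (-M.rewardBound) M.rewardBound) k p u (θ j ω)‖ ^ 2) ∂P ≤
      ENNReal.ofReal (2 * (2 * M.rewardBound) ^ 2 * B ^ 2 * (c ^ 2 + c' ^ 2) / m) := by
  set len := sublevelLength X (-M.rewardBound) M.rewardBound with hlen
  have hlen0 : ∀ V, 0 ≤ len V := fun V => sublevelLength_nonneg _ _ _ V
  have hsum : ∑ V, len V = 2 * M.rewardBound := by
    rw [hlen, sum_sublevelLength X (by linarith [M.rewardBound_pos])]
    ring
  have hpc : ∀ h, Continuous fun ϑ => p ϑ h := fun h =>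
    continuous_iff_continuousAt.2 fun ϑ => (hp.hasGradientAt ϑ h).continuousAt
  have huc : ∀ h, Continuous fun ϑ => u ϑ h := fun h => (hp.differentiable_score h).continuous
  have hkc : Continuous k := by
    refine LipschitzWith.continuous (K := c'.toNNReal) (LipschitzWith.of_dist_le_mul fun s t => ?_)
    rw [Real.coe_toNNReal _ hc', Real.dist_eq, Real.dist_eq]
    exact hk.lipschitz s t
  let f : (Fin m → H) → Param d → ℝ := fun h ϑ =>
    ‖finEstimate len k u ϑ h - finRiskGrad len k p u ϑ‖ ^ 2
  have hind : ∀ (V : Finset H) (h : H), Continuous fun ϑ => Set.indicator (V : Set H) (u ϑ) h := by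
    intro V h
    by_cases hV : h ∈ V
    · simpa [hV] using huc h
    · simpa [hV] using continuous_const
  have hfc : ∀ h, Continuous (f h) := by
    intro h
    unfold f finEstimate finRiskGrad eventMean eventProb eventGrad
    fun_prop
  have hθm := hrun.measurable_iterate j hj.le
  have hD : ∀ h : Fin m → H, ∫⁻ ω in W j ⁻¹' batchEvent K h,
      ENNReal.ofReal (‖gradEstimate M π g (θ j ω) (W j ω) - finRiskGrad len k p u (θ j ω)‖ ^ 2) ∂P =
        ∫⁻ ω, ENNReal.ofReal ((∏ i, p (θ j ω) (h i)) * f h (θ j ω)) ∂P := by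
    intro h
    have hms : MeasurableSet (W j ⁻¹' batchEvent K h) :=
      ((hrun.measurable_batch j hj).mono (ℱ.le _) le_rfl) (hK.measurableSet_batchEvent h)
    have h1 : ∀ ω ∈ W j ⁻¹' batchEvent K h,
        ENNReal.ofReal (‖gradEstimate M π g (θ j ω) (W j ω) -
          finRiskGrad len k p u (θ j ω)‖ ^ 2) = ENNReal.ofReal (f h (θ j ω)) := by
      intro ω hω
      rw [hK.gradEstimate_eq hk _ hω]
    have hqc : Continuous fun ϑ => ∏ i, p ϑ (h i) := continuous_finsetProd _ fun i _ => hpc _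
    rw [setLIntegral_congr_fun hms h1, setLIntegral_eq_lintegral_mul_of_forall_measure (ℱ.le j)
      (q := fun ω => ENNReal.ofReal (∏ i, p (θ j ω) (h i)))
      (Z := fun ω => ENNReal.ofReal (f h (θ j ω)))
      (hqc.measurable.ennreal_ofReal.comp hθm)
      ((hfc h).measurable.ennreal_ofReal.comp hθm)]
    · refine lintegral_congr fun ω => ?_
      rw [ENNReal.ofReal_mul (Finset.prod_nonneg fun i _ => (hp.pos _ _).le)]
    · intro F hF
      rw [hrun.batch_law j hj F hF _ (hK.measurableSet_batchEvent h)]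
      simp_rw [hK.batchLaw_batchEvent hp]
  have hcover : P.restrict (⋃ h : Fin m → H, W j ⁻¹' batchEvent K h) = P := by
    refine Measure.restrict_eq_self_of_ae_mem ?_
    filter_upwards [hrun.ae_mem_batchEvent hK hp hj] with ω hω
    exact Set.mem_iUnion.2 hω
  have hterm : ∀ (h : Fin m → H) ϑ, 0 ≤ (∏ i, p ϑ (h i)) * f h ϑ := fun h ϑ =>
    mul_nonneg (Finset.prod_nonneg fun i _ => (hp.pos _ _).le) (sq_nonneg _)
  have hmeas : ∀ h : Fin m → H,
      Measurable fun ω => ENNReal.ofReal ((∏ i, p (θ j ω) (h i)) * f h (θ j ω)) := fun h =>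
    (((continuous_finsetProd _ fun i _ => hpc (h i)).mul
      (hfc h)).measurable.ennreal_ofReal).comp (hθm.mono (ℱ.le j) le_rfl)
  calc _ = ∫⁻ ω in ⋃ h : Fin m → H, W j ⁻¹' batchEvent K h,
        ENNReal.ofReal (‖gradEstimate M π g (θ j ω) (W j ω) -
          finRiskGrad len k p u (θ j ω)‖ ^ 2) ∂P := by rw [hcover]
    _ ≤ ∑ h : Fin m → H, ∫⁻ ω in W j ⁻¹' batchEvent K h,
        ENNReal.ofReal (‖gradEstimate M π g (θ j ω) (W j ω) -
          finRiskGrad len k p u (θ j ω)‖ ^ 2) ∂P := by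
        refine (lintegral_iUnion_le _ _).trans_eq (tsum_fintype _)
    _ = ∫⁻ ω, ∑ h : Fin m → H, ENNReal.ofReal ((∏ i, p (θ j ω) (h i)) * f h (θ j ω)) ∂P := by
        rw [lintegral_finsetSum _ fun h _ => hmeas h]
        exact Finset.sum_congr rfl fun h _ => hD h
    _ ≤ ∫⁻ _, ENNReal.ofReal (2 * (2 * M.rewardBound) ^ 2 * B ^ 2 * (c ^ 2 + c' ^ 2) / m) ∂P := by
        refine lintegral_mono fun ω => ?_
        rw [← ENNReal.ofReal_sum_of_nonneg fun h _ => hterm h _, ← hsum]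
        exact ENNReal.ofReal_le_ofReal
          (hp.sum_norm_sq_finEstimate_sub_le hk hc' hlen0 (θ j ω) hm)
    _ = _ := by rw [lintegral_const, measure_univ, mul_one]

end IsRun

end Run

end DRM

theorem mainTheorem1
    {S A : Type*} [Finite S] [Finite A] [MeasurableSpace S] [MeasurableSpace A]
    [MeasurableSingletonClass S] [MeasurableSingletonClass A] {d : ℕ}
    (M : DRM.EpisodicMDP S A) (π : DRM.Policy d S A) (g : ℝ → ℝ)
    (Me Md Mh Mg' Mg'' : ℝ)
    (hMe : 0 < Me) (hMd : 0 < Md) (hMh : 0 < Mh) (hMg' : 0 < Mg') (hMg'' : 0 < Mg'')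
    -- the policies are proper, and `Me` bounds the episode length
    (hproper : DRM.IsProper M π)
    (hlength : ∀ θ, ∀ᵐ ω ∂(DRM.episodeLaw M π θ),
      ∃ n : ℕ, DRM.episodeLength M ω = n ∧ (n : ℝ) ≤ Me)
    -- `log π_θ(a | s)` is defined and twice differentiable in `θ`, with bounded gradient and Hessian
    (hpos : ∀ θ s a, π θ s a ≠ 0)
    (hdiff : ∀ s a, Differentiable ℝ (DRM.logPolicy π s a))
    (hdiff2 : ∀ s a, Differentiable ℝ (gradient (DRM.logPolicy π s a)))
    (hscore : ∀ θ s a, ‖gradient (DRM.logPolicy π s a) θ‖ ≤ Md)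
    (hhess : ∀ θ s a, ‖fderiv ℝ (gradient (DRM.logPolicy π s a)) θ‖ ≤ Mh)
    -- the distortion function, with bounded first and second derivatives on `(0, 1)`
    (hg : DRM.IsDistortion g)
    (hg0 : DifferentiableWithinAt ℝ g (Set.Icc 0 1) 0)
    (hg1 : ∀ t ∈ Set.Ioo (0 : ℝ) 1, DifferentiableAt ℝ g t ∧ |deriv g t| ≤ Mg')
    (hg2 : ∀ t ∈ Set.Ioo (0 : ℝ) 1,
      DifferentiableAt ℝ (deriv g) t ∧ |deriv (deriv g) t| ≤ Mg'')
    -- the run of the algorithm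
    (N m : ℕ) (hN : 1 ≤ N) (hm : 1 ≤ m) (α : ℝ) (hα : 0 < α) (θ₀ : DRM.Param d)
    {Ω : Type*} [mΩ : MeasurableSpace Ω] (P : MeasureTheory.Measure Ω)
    [MeasureTheory.IsProbabilityMeasure P] (ℱ : MeasureTheory.Filtration ℕ mΩ)
    (W : ℕ → Ω → Fin m → DRM.Trajectory S A) (θ : ℕ → Ω → DRM.Param d) (R : Ω → ℕ)
    (hrun : DRM.IsRun M π g N m α θ₀ P ℱ W θ R) :
    Differentiable ℝ (DRM.drm M π g) ∧
    BddAbove (Set.range (DRM.drm M π g)) ∧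
    MeasureTheory.Integrable (fun ω => ‖gradient (DRM.drm M π g) (θ (R ω) ω)‖ ^ 2) P ∧
    ∫ ω, ‖gradient (DRM.drm M π g) (θ (R ω) ω)‖ ^ 2 ∂P ≤
      2 * ((⨆ ϑ, DRM.drm M π g ϑ) - DRM.drm M π g θ₀) / (N * α) +
        4 * M.rewardBound ^ 2 * Me ^ 2 * Md ^ 2 *
          (α * Mg' ^ 2 * DRM.smoothConst M.rewardBound Me Md Mh Mg' Mg'' +
            8 * (Real.exp 1 ^ 2 * Mg' ^ 2 + Mg'' ^ 2) / m) := by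
  obtain ⟨H, _, K, X, p, u, hp, hK⟩ := DRM.exists_isEpisodePartition M π hMd hMh hlength hpos
    hdiff hdiff2 hscore hhess
  obtain ⟨k, hk⟩ := DRM.exists_isDistortionDeriv hMg''.le hg0 hg1 hg2
  have hMr := M.rewardBound_pos
  set Mr := M.rewardBound with hMr_def
  set len := DRM.sublevelLength X (-Mr) Mr with hlen
  have hlen0 : ∀ V, 0 ≤ len V := fun V => DRM.sublevelLength_nonneg _ _ _ V
  have hsum : ∑ V, len V = 2 * Mr := by
    rw [hlen, DRM.sum_sublevelLength X (by linarith)]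
    ring
  set ρ := DRM.drm M π g with hρ
  set D := DRM.finRiskGrad len k p u with hD
  set L := DRM.smoothConst Mr Me Md Mh Mg' Mg'' with hL
  set G := 2 * Mr * (Mg' * (Me * Md)) with hG
  have hL0 : 0 < L := by rw [hL, DRM.smoothConst]; positivity
  have hgrad : ∀ x, HasGradientAt ρ (D x) x := by
    intro x
    have h1 : ρ = fun ϑ => DRM.finRisk len g p ϑ - Mr := funext fun ϑ => hK.drm_eq hp g ϑ
    rw [h1, hasGradientAt_iff_hasFDerivAt]
    exact (hp.hasGradientAt_finRisk hk len x).hasFDerivAt.sub_const Mr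
  have hlip : ∀ x y, ‖D x - D y‖ ≤ L * ‖x - y‖ := by
    intro x y
    refine (hp.norm_finRiskGrad_sub_le hk hMg''.le hlen0 x y).trans_eq ?_
    rw [hsum, hL, DRM.smoothConst]
    ring
  have hDG : ∀ x, ‖D x‖ ≤ G := fun x => by
    simpa only [hsum, hG] using hp.norm_finRiskGrad_le hk hlen0 x
  have hρb : ∀ x, |ρ x| ≤ 3 * Mr := by
    intro x
    have h1 := hp.abs_finRisk_le hg hlen0 x
    have h2 : ρ x = DRM.finRisk len g p x - Mr := hK.drm_eq hp g x
    rw [hsum, abs_le] at h1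
    rw [h2, abs_le]
    constructor <;> linarith [h1.1, h1.2]
  have hbdd : BddAbove (Set.range ρ) := ⟨3 * Mr, by
    rintro _ ⟨x, rfl⟩
    exact (abs_le.1 (hρb x)).2⟩
  have hsup : ∀ x, ρ x ≤ ⨆ ϑ, ρ ϑ := fun x => le_ciSup hbdd x
  have hDc : Continuous D := by
    refine LipschitzWith.continuous (K := L.toNNReal) (LipschitzWith.of_dist_le_mul fun x y => ?_)
    rw [Real.coe_toNNReal _ hL0.le, dist_eq_norm, dist_eq_norm]
    exact hlip x y
  have hθm : ∀ j ≤ N, Measurable (θ j) := fun j hj =>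
    (hrun.measurable_iterate j hj).mono (ℱ.le j) le_rfl
  have hsq : ∀ x, |‖D x‖ ^ 2| ≤ G ^ 2 := fun x => by
    rw [abs_of_nonneg (sq_nonneg _)]
    exact pow_le_pow_left₀ (norm_nonneg _) (hDG x) 2
  have hDsq : Measurable fun x => ‖D x‖ ^ 2 := (hDc.norm.pow 2).measurable
  obtain ⟨hint, havg⟩ := DRM.integral_uniform_index hN hθm hrun.measurable_index
    hrun.index_uniform hrun.index_indep hDsq hsq
  have hN0 : (0 : ℝ) < N := by exact_mod_cast hN
  have hm0 : (0 : ℝ) < m := by exact_mod_cast hm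
  rw [gradient_eq hgrad]
  refine ⟨fun x => (hgrad x).differentiableAt, hbdd, hint, ?_⟩
  have hvar : 0 ≤ 4 * Mr ^ 2 * Me ^ 2 * Md ^ 2 *
      (8 * (Real.exp 1 ^ 2 * Mg' ^ 2 + Mg'' ^ 2) / m) := by positivity
  -- The threshold is what the bound on the last iterate requires.
  rcases le_or_gt (α * L) 1 with hαL | hαL
  · set σ := 2 * (2 * Mr) ^ 2 * (Me * Md) ^ 2 * (Mg' ^ 2 + Mg'' ^ 2) / m with hσ
    have hσ0 : 0 ≤ σ := by positivity
    have hσle : σ ≤ 4 * Mr ^ 2 * Me ^ 2 * Md ^ 2 *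
        (8 * (Real.exp 1 ^ 2 * Mg' ^ 2 + Mg'' ^ 2) / m) := by
      -- The variance bound has the factor `2 * (Mg' ^ 2 + Mg'' ^ 2)`, which the stated constant
      -- dominates.
      have he : 1 ≤ Real.exp 1 ^ 2 := one_le_pow₀ (Real.one_le_exp zero_le_one)
      have h1 : 2 * (Mg' ^ 2 + Mg'' ^ 2) ≤ 8 * (Real.exp 1 ^ 2 * Mg' ^ 2 + Mg'' ^ 2) := by
        nlinarith [sq_nonneg Mg', sq_nonneg Mg'']
      calc σ = 4 * Mr ^ 2 * Me ^ 2 * Md ^ 2 * (2 * (Mg' ^ 2 + Mg'' ^ 2) / m) := by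
            rw [hσ]; ring
        _ ≤ _ := by gcongr
    have hsteps : ∀ j < N, ∫ ω, ρ (θ j ω) ∂P + α / 2 * ∫ ω, ‖D (θ j ω)‖ ^ 2 ∂P -
        (α / 2 * σ + L / 2 * α ^ 2 * G ^ 2) ≤ ∫ ω, ρ (θ (j + 1) ω) ∂P := by
      intro j hj
      -- The estimate is a rescaled increment of the iterates, so it inherits their measurability.
      have he : Measurable fun ω => DRM.gradEstimate M π g (θ j ω) (W j ω) := by
        have h1 : (fun ω => DRM.gradEstimate M π g (θ j ω) (W j ω)) =
            fun ω => α⁻¹ • (θ (j + 1) ω - θ j ω) := by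
          funext ω
          rw [hrun.update j hj ω, add_sub_cancel_left, smul_smul, inv_mul_cancel₀ hα.ne', one_smul]
        rw [h1]
        exact ((hθm (j + 1) hj).sub (hθm j hj.le)).const_smul α⁻¹
      have h2 := DRM.integral_le_integral_gradient_step hL0.le hgrad hlip hρb hα hDG hDc
        (hθm j hj.le) he (hrun.ae_norm_gradEstimate_le hK hp hk hj) hσ0
        (hrun.lintegral_norm_sq_gradEstimate_sub_le hK hp hk hMg''.le hm hj)
      simpa only [hrun.update j hj] using h2
    have hρm : Measurable ρ :=
      (continuous_iff_continuousAt.2 fun x => (hgrad x).continuousAt).measurable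
    have hρint : Integrable (fun ω => ρ (θ N ω)) P :=
      Integrable.of_bound (hρm.comp (hθm N le_rfl)).aestronglyMeasurable (3 * Mr)
        (ae_of_all _ fun ω => hρb _)
    have hlast : α / 2 * ∫ ω, ‖D (θ N ω)‖ ^ 2 ∂P ≤ (⨆ ϑ, ρ ϑ) - ∫ ω, ρ (θ N ω) ∂P := by
      have h1 : ∀ ω, α / 2 * ‖D (θ N ω)‖ ^ 2 ≤ (⨆ ϑ, ρ ϑ) - ρ (θ N ω) := by
        intro ω
        have h2 := DRM.norm_sq_gradient_le_of_bddAbove hL0 hgrad hlip hsup (θ N ω)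
        have h3 : 0 ≤ (⨆ ϑ, ρ ϑ) - ρ (θ N ω) := sub_nonneg.2 (hsup _)
        calc α / 2 * ‖D (θ N ω)‖ ^ 2 ≤ α / 2 * (2 * L * ((⨆ ϑ, ρ ϑ) - ρ (θ N ω))) := by gcongr
          _ = α * L * ((⨆ ϑ, ρ ϑ) - ρ (θ N ω)) := by ring
          _ ≤ _ := mul_le_of_le_one_left h3 hαL
      have hint2 : Integrable (fun ω => ‖D (θ N ω)‖ ^ 2) P :=
        Integrable.of_bound (hDsq.comp (hθm N le_rfl)).aestronglyMeasurable (G ^ 2)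
          (ae_of_all _ fun ω => hsq _)
      have h4 := integral_mono (hint2.const_mul (α / 2))
        ((integrable_const (⨆ ϑ, ρ ϑ)).sub hρint) h1
      rw [integral_const_mul, integral_sub' (integrable_const _) hρint, integral_const,
        probReal_univ, one_smul] at h4
      exact h4
    have htotal := DRM.sum_le_of_ascent hN (F := fun j => ∫ ω, ρ (θ j ω) ∂P)
      (s := fun j => ∫ ω, ‖D (θ j ω)‖ ^ 2 ∂P) (half_pos hα).le
      (integral_nonneg fun ω => sq_nonneg _) hsteps hlast
    have h0 : ∫ ω, ρ (θ 0 ω) ∂P = ρ θ₀ := by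
      simp [hrun.init]
    rw [h0] at htotal
    rw [havg]
    calc (N : ℝ)⁻¹ * ∑ j ∈ Finset.Icc 1 N, ∫ ω, ‖D (θ j ω)‖ ^ 2 ∂P
        = 2 / (N * α) * (α / 2 * ∑ j ∈ Finset.Icc 1 N, ∫ ω, ‖D (θ j ω)‖ ^ 2 ∂P) := by
          field_simp
      _ ≤ 2 / (N * α) * ((⨆ ϑ, ρ ϑ) - ρ θ₀ + N * (α / 2 * σ + L / 2 * α ^ 2 * G ^ 2)) := by
          gcongr
      _ = 2 * ((⨆ ϑ, ρ ϑ) - ρ θ₀) / (N * α) + (σ + α * L * G ^ 2) := by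
          field_simp
      _ ≤ _ := by
          have h5 : α * L * G ^ 2 = 4 * Mr ^ 2 * Me ^ 2 * Md ^ 2 * (α * Mg' ^ 2 * L) := by
            rw [hG]; ring
          rw [h5, mul_add (4 * Mr ^ 2 * Me ^ 2 * Md ^ 2)]
          linarith
  -- For a large step-size the uniform bound `G ^ 2` is already below the term `α * L * G ^ 2` of
  -- the claim.
  · have h1 : ∫ ω, ‖D (θ (R ω) ω)‖ ^ 2 ∂P ≤ G ^ 2 := by
      refine (integral_mono hint (integrable_const (G ^ 2)) fun ω =>
        (le_abs_self _).trans (hsq _)).trans_eq ?_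
      rw [integral_const, probReal_univ, one_smul]
    have h2 : 0 ≤ 2 * ((⨆ ϑ, ρ ϑ) - ρ θ₀) / (N * α) :=
      div_nonneg (mul_nonneg zero_le_two (sub_nonneg.2 (hsup _))) (by positivity)
    have h3 : G ^ 2 ≤ 4 * Mr ^ 2 * Me ^ 2 * Md ^ 2 * (α * Mg' ^ 2 * L) := by
      calc G ^ 2 ≤ α * L * G ^ 2 := le_mul_of_one_le_left (sq_nonneg _) hαL.le
        _ = _ := by rw [hG]; ring
    rw [mul_add (4 * Mr ^ 2 * Me ^ 2 * Md ^ 2)]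
    linarith
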